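/- Let $d\ge 2$ and let $\{\eta_t\}_{t\ge 0}$ be the symmetric simple exclusion process on $\mathbb Z^d$, i.e. the Markov process on $\{0,1\}^{\mathbb Z^d}$ with generator $$\mathcal L_d f(\eta)=\frac1{2d}\sum_{k\in\mathbb Z^d}\ \sum_{|y-k|=1}\eta(k)(1-\eta(y))\big(f(\eta^{k,y})-f(\eta)\big)$$ for functions $f$ depending on finitely many coordinates, where $\eta^{k,y}$ is $\eta$ with the values at $k$ and $y$ exchanged. For $i=2,\dots,d$ let $g_i(u)=c_iu^{\alpha_i}+r_i$ for $u\ge 0$, with $c_i\in(0,\infty)$ and $\alpha_i,r_i\in[0,\infty)$ (so $g_i\equiv c_i+r_i$ if $\alpha_i=0$), and start the process from $$\eta_0(k)=1\big(k_1\le 0,\ |k_i|\le g_i(-k_1)\text{ for } i=2,\dots,d\big),\qquad k\in\mathbb Z^d .$$ Let $\beta=1+\sum_{i=2}^d\alpha_i$ and $$a_t=\log\Big(\frac{t}{(2\pi)^{1/(2\beta)}(\log t)^{(\beta+1)/(2\beta)}}\Big),\qquad b_t=\Big(\frac{\beta t}{d\log t}\Big)^{1/2}.$$ Fix $x\in\mathbb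 R$, put $z=z(t)=b_t(x+a_t)$, and let $N_t=\sum_{k\in\mathbb Z^d:\,k_1>z}\eta_t(k)$ be the number of particles at time $t$ whose first coordinate exceeds $z$. Then $$\lim_{t\to\infty}E[N_t]=Me^{-\beta x},\qquad M=\frac{\Gamma(\beta)}{d^{\beta/2}\beta^{(\beta+1)/2}}\Big(\prod_{i:\,\alpha_i=0}(2\lfloor c_i+r_i\rfloor+1)\Big)\Big(\prod_{i:\,\alpha_i>0}2c_i\Big).$$ -/

import Mathlib

open MeasureTheory Filter Topology
open scoped NNReal ENNReal

noncomputable section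

namespace SSEP

/-- The lattice `ℤ^d`. -/
abbrev Site (d : ℕ) := Fin d → ℤ

/-- Configurations `η ∈ {0,1}^{ℤ^d}`, with the product topology and product σ-algebra;
`η k = true` means that site `k` is occupied. -/
abbrev Config (d : ℕ) := Site d → Bool

/-- The `i`-th standard basis vector of `ℤ^d`. -/
def e {d : ℕ} (i : Fin d) : Site d := Pi.single i 1

/-- The occupation number `η(k) ∈ {0,1}` as a real number. -/
def occ {d : ℕ} (η : Config d) (k : Site d) : ℝ := if η k then 1 else 0

/-- The configuration `η^{x,y}`, in which the values at `x` and `y` are exchanged. -/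
def exchange {d : ℕ} (η : Config d) (x y : Site d) : Config d := fun k => η (Equiv.swap x y k)

/-- `f` depends on finitely many coordinates only. -/
def IsLocal {d : ℕ} (f : Config d → ℝ) : Prop := ∃ A : Finset (Site d), DependsOn f (A : Set (Site d))

/-- The contribution `η(x) (1 - η(y)) (f(η^{x,y}) - f(η))` of the attempted jump `x → y`. -/
def jumpTerm {d : ℕ} (f : Config d → ℝ) (η : Config d) (x y : Site d) : ℝ :=
  occ η x * (1 - occ η y) * (f (exchange η x y) - f η)

/-- The generator of the symmetric simple exclusion process on `ℤ^d`,
`(L f)(η) = (1 / 2d) ∑_x ∑_{|y - x| = 1} η(x) (1 - η(y)) (f(η^{x,y}) - f(η))`.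
For local `f` only finitely many `x` contribute. -/
def generator (d : ℕ) (f : Config d → ℝ) (η : Config d) : ℝ :=
  1 / (2 * (d : ℝ)) *
    ∑' x : Site d, ∑ i : Fin d, (jumpTerm f η x (x + e i) + jumpTerm f η x (x - e i))

/-- `η` is a symmetric simple exclusion process on `ℤ^d` started from `η₀`: an adapted process with
right-continuous paths with left limits that solves the martingale problem for the generator on
local functions. -/
structure IsSSEP {d : ℕ} {Ω : Type*} {m : MeasurableSpace Ω} (μ : Measure Ω)
    (ℱ : Filtration ℝ≥0 m) (η : ℝ≥0 → Ω → Config d) (η₀ : Config d) : Prop where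
  adapted : ∀ t, Measurable[ℱ t] (η t)
  initial : ∀ᵐ ω ∂μ, η 0 ω = η₀
  right_continuous : ∀ ω t, ContinuousWithinAt (fun s => η s ω) (Set.Ici t) t
  left_limits : ∀ ω t, ∃ l, Tendsto (fun s => η s ω) (𝓝[<] t) (𝓝 l)
  martingale : ∀ f : Config d → ℝ, IsLocal f →
    Martingale
      (fun (t : ℝ≥0) ω => f (η t ω) - ∫ s in (0 : ℝ)..t, generator d f (η s.toNNReal ω)) ℱ μ

/-- The number `N(z) ∈ {0, 1, …, ∞}` of particles `k` of `η` with first coordinate `k₁ > z`. -/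
def numAbove {n : ℕ} (z : ℝ) (η : Config (n + 1)) : ℝ≥0∞ :=
  ∑' k : {k : Site (n + 1) // z < (k 0 : ℝ)}, if η k then 1 else 0

open Classical in
/-- The initial profile in dimension `d = n + 1` with shape functions `g`: site `k` is occupied iff
`k₁ ≤ 0` and `|k_i| ≤ g_i(-k₁)` for each of the remaining `n` coordinates. The first coordinate is
`k 0`, and `g i` is the shape function for the coordinate `k i.succ`. -/
def profile {n : ℕ} (g : Fin n → ℝ → ℝ) : Config (n + 1) := fun k =>
  decide (k 0 ≤ 0 ∧ ∀ i : Fin n, |(k i.succ : ℝ)| ≤ g i (-(k 0 : ℝ)))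

/-- The polynomial shapes `g_i(u) = c_i u^{α_i} + r_i` (with `u^0 = 1`). -/
def polyShape {n : ℕ} (c α r : Fin n → ℝ) (i : Fin n) (u : ℝ) : ℝ := c i * u ^ α i + r i

/-- `β = 1 + ∑ α_i`. -/
def beta {n : ℕ} (α : Fin n → ℝ) : ℝ := 1 + ∑ i, α i

/-- `a_t = log (t / ((2π)^{1/(2β)} (log t)^{(β+1)/(2β)}))`. -/
def aScale (β t : ℝ) : ℝ :=
  Real.log (t / ((2 * Real.pi) ^ (1 / (2 * β)) * Real.log t ^ ((β + 1) / (2 * β))))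

/-- `b_t = (β t / (d log t))^{1/2}`. -/
def bScale (d : ℕ) (β t : ℝ) : ℝ := Real.sqrt (β * t / (d * Real.log t))

/-- The level `z = b_t (x + a_t)`. -/
def level (d : ℕ) (β x t : ℝ) : ℝ := bScale d β t * (x + aScale β t)

open Classical in
/-- The constant
`M = Γ(β) / (d^{β/2} β^{(β+1)/2}) ∏_{α_i = 0} (2⌊c_i + r_i⌋ + 1) ∏_{α_i > 0} 2 c_i`
in dimension `d = n + 1`. -/
def limitConst {n : ℕ} (c α r : Fin n → ℝ) : ℝ :=
  Real.Gamma (beta α) / (((n + 1 : ℕ) : ℝ) ^ (beta α / 2) * beta α ^ ((beta α + 1) / 2)) *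
    (∏ i with α i = 0, (2 * (⌊c i + r i⌋ : ℝ) + 1)) * ∏ i with 0 < α i, 2 * c i

end SSEP

end

/-! Exclusion is invisible at the level of first moments. In the generator applied to an occupation
number, the products of neighbouring occupation numbers cancel between inflow and outflow, so the
mean occupation solves the linear lattice heat equation (`generator_occ`, `IsSSEP.meanOcc_eq`).
Iterating its integral form shows that it is the initial profile averaged over a simple random walk
with a Poisson number of steps (`IsSSEP.hasSum_meanOcc`). Summing over hyperplanes leaves only the
first coordinate, and by `lintegral_numAbove` the mean of `numAbove` is a double sum, over heights j
above the level and depths u below the origin, of a one-dimensional heat kernel times the size of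
the initial cross section at depth u.

The level z is so far out that a plain local limit theorem does not suffice. The Fourier integral is
therefore taken along the line with real part θ = z/(t/d) (`heatKernel_eq`). This splits off an
explicit exponential weight and leaves an integral that obeys a Gaussian limit
(`tendsto_sqrt_mul_tiltedIntegral`). Since θ b_t → β, the kernel decays like e^{-β(v+w)} at j = b_t
v, u = b_t w, while the cross section grows like (b_t w)^{β-1}. The choice of a_t is exactly what
makes the total weight converge, to a multiple of e^{-βx} (`tendsto_tiltWeight`).

Rewriting the double sum as an integral over the quadrant and using dominated convergence
(`rescaledSummand_le`, `tendsto_rescaledSummand`) gives the limit, whose integral factors into ∫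
e^{-βv} dv = 1/β and ∫ w^{β-1} e^{-βw} dw = Γ(β)/β^β. -/

noncomputable section

namespace SSEP

/-! ### Neighbour averages and the generator on occupation numbers. -/

/-- The average of `f` over the `2d` neighbours of `k`. -/
def nbrAvg {d : ℕ} (f : Site d → ℝ) (k : Site d) : ℝ :=
  1 / (2 * (d : ℝ)) * ∑ i : Fin d, (f (k + e i) + f (k - e i))

lemma occ_nonneg {d : ℕ} (η : Config d) (k : Site d) : 0 ≤ occ η k := by
  unfold occ; split_ifs <;> norm_num

lemma occ_le_one {d : ℕ} (η : Config d) (k : Site d) : occ η k ≤ 1 := by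
  unfold occ; split_ifs <;> norm_num

lemma nbrAvg_nonneg {d : ℕ} {f : Site d → ℝ} (hf : ∀ k, 0 ≤ f k) (k : Site d) :
    0 ≤ nbrAvg f k := by
  unfold nbrAvg
  have : 0 ≤ ∑ i : Fin d, (f (k + e i) + f (k - e i)) :=
    Finset.sum_nonneg fun i _ => add_nonneg (hf _) (hf _)
  positivity

lemma abs_nbrAvg_le {d : ℕ} {f : Site d → ℝ} {B : ℝ} (hB : 0 ≤ B) (hf : ∀ k, |f k| ≤ B)
    (k : Site d) : |nbrAvg f k| ≤ B := by
  unfold nbrAvg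
  rcases Nat.eq_zero_or_pos d with rfl | hd
  · simpa using hB
  have hd' : (0 : ℝ) < d := by exact_mod_cast hd
  have : |∑ i : Fin d, (f (k + e i) + f (k - e i))| ≤ ∑ _i : Fin d, (B + B) :=
    (Finset.abs_sum_le_sum_abs _ _).trans <| Finset.sum_le_sum fun i _ =>
      (abs_add_le _ _).trans (add_le_add (hf _) (hf _))
  rw [abs_mul, abs_of_pos (by positivity : (0 : ℝ) < 1 / (2 * (d : ℝ)))]
  calc 1 / (2 * (d : ℝ)) * _ ≤ 1 / (2 * (d : ℝ)) * ∑ _i : Fin d, (B + B) := by gcongr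
    _ = B := by simp; field_simp; ring

lemma nbrAvg_sub {d : ℕ} (f g : Site d → ℝ) (k : Site d) :
    nbrAvg (fun j => f j - g j) k = nbrAvg f k - nbrAvg g k := by
  simp only [nbrAvg, ← mul_sub, ← Finset.sum_sub_distrib]
  congr 1
  exact Finset.sum_congr rfl fun i _ => by ring

lemma nbrAvg_const_mul {d : ℕ} (c : ℝ) (f : Site d → ℝ) (k : Site d) :
    nbrAvg (fun j => c * f j) k = c * nbrAvg f k := by
  simp only [nbrAvg, Finset.mul_sum]
  exact Finset.sum_congr rfl fun i _ => by ring

lemma nbrAvg_finset_sum {d : ℕ} {ι : Type*} (s : Finset ι) (f : ι → Site d → ℝ) (k : Site d) :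
    nbrAvg (fun j => ∑ a ∈ s, f a j) k = ∑ a ∈ s, nbrAvg (f a) k := by
  simp only [nbrAvg, ← Finset.mul_sum, ← Finset.sum_add_distrib]
  rw [Finset.sum_comm]

lemma e_ne_zero {d : ℕ} (i : Fin d) : (e i : Site d) ≠ 0 := by
  simp [e]

/-- Along direction v, only a jump out of k or a jump into k from k - v can change the value at k.
-/
lemma jumpTerm_occ {d : ℕ} (η : Config d) (k x v : Site d) (hv : v ≠ 0) :
    jumpTerm (fun ξ => occ ξ k) η x (x + v) =
      (if x = k then -(occ η k * (1 - occ η (k + v))) else 0) +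
        (if x = k - v then occ η (k - v) * (1 - occ η k) else 0) := by
  have hex : occ (exchange η x (x + v)) k = occ η (Equiv.swap x (x + v) k) := rfl
  simp only [jumpTerm, hex]
  by_cases h1 : x = k
  · subst h1
    have : x ≠ x - v := by
      intro h; exact hv (by simpa using h.symm)
    rw [if_pos rfl, if_neg this, Equiv.swap_apply_left]
    unfold occ
    split_ifs <;> norm_num
  · by_cases h2 : x = k - v
    · have h3 : k = x + v := by rw [h2]; abel
      rw [if_neg h1, if_pos h2, ← h2, ← h3, Equiv.swap_apply_right]
      unfold occ
      split_ifs <;> norm_num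
    · have h3 : k ≠ x + v := fun h => h2 (by rw [h]; abel)
      rw [if_neg h1, if_neg h2, Equiv.swap_apply_of_ne_of_ne (Ne.symm h1) h3]
      ring

/-- The quadratic terms η(k)η(k ± e_i) occur with opposite signs in the outflow and the inflow, so
the exclusion rule drops out and the first moments satisfy a closed linear equation. -/
lemma generator_occ {d : ℕ} (hd : 0 < d) (k : Site d) (η : Config d) :
    generator d (fun ξ => occ ξ k) η = nbrAvg (occ η) k - occ η k := by
  have hd' : (d : ℝ) ≠ 0 := by exact_mod_cast hd.ne'
  have hs : HasSum (fun x : Site d => ∑ i : Fin d, (jumpTerm (fun ξ => occ ξ k) η x (x + e i) +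
      jumpTerm (fun ξ => occ ξ k) η x (x - e i)))
      (∑ i : Fin d, ((-(occ η k * (1 - occ η (k + e i))) + occ η (k - e i) * (1 - occ η k)) +
        (-(occ η k * (1 - occ η (k - e i))) + occ η (k + e i) * (1 - occ η k)))) := by
    refine hasSum_sum fun i _ => ?_
    refine HasSum.add ?_ ?_
    · simp only [jumpTerm_occ η k _ _ (e_ne_zero i)]
      exact (hasSum_ite_eq _ _).add (hasSum_ite_eq _ _)
    · have : ∀ x, jumpTerm (fun ξ => occ ξ k) η x (x - e i) = _ := fun x => by
        rw [sub_eq_add_neg, jumpTerm_occ η k x _ (neg_ne_zero.2 (e_ne_zero i))]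
      simp only [this, sub_neg_eq_add, ← sub_eq_add_neg]
      exact (hasSum_ite_eq _ _).add (hasSum_ite_eq _ _)
  rw [generator, hs.tsum_eq, nbrAvg]
  have : ∑ i : Fin d, ((-(occ η k * (1 - occ η (k + e i))) + occ η (k - e i) * (1 - occ η k)) +
        (-(occ η k * (1 - occ η (k - e i))) + occ η (k + e i) * (1 - occ η k))) =
      ∑ i : Fin d, (occ η (k + e i) + occ η (k - e i)) - d * (2 * occ η k) := by
    have : (d : ℝ) * (2 * occ η k) = ∑ _i : Fin d, 2 * occ η k := by simp
    rw [this, ← Finset.sum_sub_distrib]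
    exact Finset.sum_congr rfl fun i _ => by ring
  rw [this]
  field_simp

lemma isLocal_occ {d : ℕ} (k : Site d) : IsLocal (fun ξ : Config d => occ ξ k) := by
  refine ⟨{k}, fun x y h => ?_⟩
  simp only [occ, h k (by simp)]

lemma measurable_occ {d : ℕ} (k : Site d) : Measurable (fun ξ : Config d => occ ξ k) := by
  have : Measurable fun b : Bool => if b then (1 : ℝ) else 0 := measurable_of_countable _
  exact this.comp (measurable_pi_apply k)

lemma measurable_nbrAvg {d : ℕ} {X : Type*} [MeasurableSpace X] {f : X → Site d → ℝ}
    (hf : ∀ k, Measurable fun x => f x k) (k : Site d) : Measurable fun x => nbrAvg (f x) k := by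
  unfold nbrAvg
  exact (Finset.measurable_sum _ fun i _ => (hf _).add (hf _)).const_mul _

lemma integral_nbrAvg {d : ℕ} {X : Type*} [MeasurableSpace X] {μ : Measure X}
    {f : X → Site d → ℝ} (hf : ∀ k, Integrable (fun x => f x k) μ) (k : Site d) :
    ∫ x, nbrAvg (f x) k ∂μ = nbrAvg (fun j => ∫ x, f x j ∂μ) k := by
  unfold nbrAvg
  rw [integral_const_mul, integral_finsetSum _ fun i _ => by exact (hf _).add (hf _)]
  congr 1
  exact Finset.sum_congr rfl fun i _ => integral_add (hf _) (hf _)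

/-! ### The mean occupation number and its evolution equation. -/

section MeanOccupation

variable {d : ℕ} {Ω : Type*} {m : MeasurableSpace Ω} {μ : Measure Ω}
  {ℱ : Filtration ℝ≥0 m} {η : ℝ≥0 → Ω → Config d} {η₀ : Config d}

/-- Joint measurability is needed for Fubini. The time s is replaced by the grid point (⌊(N+1)s⌋ +
1)/(N+1), which lies to its right and takes countably many values; right-continuity of the paths
then gives the pointwise limit. -/
lemma IsSSEP.measurable_uncurry (hη : IsSSEP μ ℱ η η₀) :
    Measurable (fun p : ℝ × Ω => η p.1.toNNReal p.2) := by
  refine measurable_pi_lambda _ fun k => ?_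
  have hm : ∀ s, Measurable (η s) := fun s => (hη.adapted s).mono (ℱ.le s) le_rfl
  obtain ⟨ψ, hψ⟩ : ∃ ψ : ℕ → ℕ → ℝ≥0, ∀ N j, ψ N j = ((j : ℝ≥0) + 1) / (N + 1) :=
    ⟨_, fun _ _ => rfl⟩
  obtain ⟨κ, hκ⟩ : ∃ κ : ℕ → ℝ≥0 → ℕ, ∀ N s, κ N s = ⌊(N + 1 : ℝ≥0) * s⌋₊ :=
    ⟨_, fun _ _ => rfl⟩
  have hκm : ∀ N, Measurable (κ N) := fun N => by
    rw [show κ N = fun s => ⌊(N + 1 : ℝ≥0) * s⌋₊ from funext (hκ N)]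
    exact Nat.measurable_floor.comp (measurable_id.const_mul _)
  have hφ : ∀ s N, s ≤ ψ N (κ N s) := fun s N => by
    rw [hψ, hκ, le_div_iff₀ (by positivity), mul_comm]
    exact (Nat.lt_floor_add_one _).le
  have hφ' : ∀ s N, ψ N (κ N s) ≤ s + 1 / (N + 1) := fun s N => by
    have h1 : ((⌊(N + 1 : ℝ≥0) * s⌋₊ : ℝ≥0)) ≤ (N + 1) * s := Nat.floor_le (by positivity)
    calc ψ N (κ N s) ≤ ((N + 1) * s + 1) / (N + 1) := by rw [hψ, hκ]; gcongr
      _ = s + 1 / (N + 1) := by field_simp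
  have hlim : ∀ s, Tendsto (fun N => ψ N (κ N s)) atTop (𝓝[Set.Ici s] s) := fun s => by
    refine tendsto_nhdsWithin_iff.2 ⟨?_, Eventually.of_forall fun N => hφ s N⟩
    refine tendsto_of_tendsto_of_tendsto_of_le_of_le tendsto_const_nhds ?_ (hφ s) (hφ' s)
    have : Tendsto (fun N : ℕ => s + 1 / ((N : ℝ≥0) + 1)) atTop (𝓝 (s + 0)) :=
      tendsto_const_nhds.add tendsto_one_div_add_atTop_nhds_zero_nat
    simpa using this
  refine measurable_of_tendsto_metrizable
    (f := fun N (p : ℝ × Ω) => η (ψ N (κ N p.1.toNNReal)) p.2 k) (fun N => ?_) ?_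
  · have h1 : Measurable fun q : ℕ × Ω => η (ψ N q.1) q.2 k :=
      measurable_from_prod_countable_right fun j => (measurable_pi_apply k).comp (hm (ψ N j))
    have h2 : Measurable fun p : ℝ × Ω => (κ N p.1.toNNReal, p.2) :=
      ((hκm N).comp (measurable_real_toNNReal.comp measurable_fst)).prodMk measurable_snd
    exact h1.comp h2
  · rw [tendsto_pi_nhds]
    rintro ⟨s, ω⟩
    have h := (hη.right_continuous ω s.toNNReal).tendsto.comp (hlim s.toNNReal)
    exact (tendsto_pi_nhds.1 h) k

/-- The mean occupation number `E[η_t(k)]`. -/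
def meanOcc (μ : Measure Ω) (η : ℝ≥0 → Ω → Config d) (t : ℝ) (k : Site d) : ℝ :=
  ∫ ω, occ (η t.toNNReal ω) k ∂μ

lemma IsSSEP.measurable_occ_uncurry (hη : IsSSEP μ ℱ η η₀) (k : Site d) :
    Measurable (fun p : ℝ × Ω => occ (η p.1.toNNReal p.2) k) :=
  (measurable_occ k).comp hη.measurable_uncurry

lemma IsSSEP.integrable_occ [IsProbabilityMeasure μ] (hη : IsSSEP μ ℱ η η₀) (t : ℝ) (k : Site d) :
    Integrable (fun ω => occ (η t.toNNReal ω) k) μ :=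
  Integrable.of_bound (C := 1)
    ((hη.measurable_occ_uncurry k).comp measurable_prodMk_left).aestronglyMeasurable
    (Eventually.of_forall fun ω => by
      rw [Real.norm_of_nonneg (occ_nonneg _ _)]; exact occ_le_one _ _)

lemma meanOcc_nonneg (t : ℝ) (k : Site d) : 0 ≤ meanOcc μ η t k :=
  integral_nonneg fun _ => occ_nonneg _ _

lemma IsSSEP.meanOcc_le_one [IsProbabilityMeasure μ] (hη : IsSSEP μ ℱ η η₀) (t : ℝ) (k : Site d) :
    meanOcc μ η t k ≤ 1 := by
  calc meanOcc μ η t k ≤ ∫ _ω, (1 : ℝ) ∂μ :=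
        integral_mono (hη.integrable_occ t k) (integrable_const _) fun _ => occ_le_one _ _
    _ = 1 := by simp

lemma IsSSEP.measurable_meanOcc [IsProbabilityMeasure μ] (hη : IsSSEP μ ℱ η η₀) (k : Site d) :
    Measurable fun t => meanOcc μ η t k := by
  have := (hη.measurable_occ_uncurry k).stronglyMeasurable.integral_prod_right' (ν := μ)
  exact this.measurable

lemma IsSSEP.abs_meanOcc_le [IsProbabilityMeasure μ] (hη : IsSSEP μ ℱ η η₀) (t : ℝ) (k : Site d) :
    |meanOcc μ η t k| ≤ 1 := by
  rw [abs_of_nonneg (meanOcc_nonneg _ _)]; exact hη.meanOcc_le_one t k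

/-- The martingale for the observable η(k) has constant expectation; the drift is bounded, so time
integral and expectation can be exchanged. -/
lemma IsSSEP.meanOcc_eq [IsProbabilityMeasure μ] (hd : 0 < d) (hη : IsSSEP μ ℱ η η₀) {t : ℝ} (ht : 0 ≤ t) (k : Site d) :
    meanOcc μ η t k = occ η₀ k +
      ∫ s in (0 : ℝ)..t, (nbrAvg (meanOcc μ η s) k - meanOcc μ η s k) := by
  have hM := hη.martingale _ (isLocal_occ k)
  have h0 := hM.setIntegral_eq (zero_le (a := t.toNNReal)) (s := Set.univ) MeasurableSet.univ
  simp only [Measure.restrict_univ, NNReal.coe_zero, intervalIntegral.integral_same,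
    sub_zero, generator_occ hd, Real.coe_toNNReal t ht] at h0
  have hgm : Measurable fun p : ℝ × Ω =>
      nbrAvg (occ (η p.1.toNNReal p.2)) k - occ (η p.1.toNNReal p.2) k :=
    (measurable_nbrAvg (fun j => hη.measurable_occ_uncurry j) k).sub
      (hη.measurable_occ_uncurry k)
  have hgb : ∀ p : ℝ × Ω,
      ‖nbrAvg (occ (η p.1.toNNReal p.2)) k - occ (η p.1.toNNReal p.2) k‖ ≤ 2 := fun p => by
    have hb : ∀ j, |occ (η p.1.toNNReal p.2) j| ≤ 1 := fun j => by
      rw [abs_of_nonneg (occ_nonneg _ _)]; exact occ_le_one _ _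
    have := abs_nbrAvg_le zero_le_one hb k
    rw [Real.norm_eq_abs]
    linarith [abs_sub (nbrAvg (occ (η p.1.toNNReal p.2)) k) (occ (η p.1.toNNReal p.2) k), hb k]
  have : IsFiniteMeasure (volume.restrict (Set.uIoc 0 t)) := ⟨by simp [Set.uIoc_of_le ht]⟩
  have hgi : Integrable (Function.uncurry fun (s : ℝ) ω =>
      nbrAvg (occ (η s.toNNReal ω)) k - occ (η s.toNNReal ω) k)
      ((volume.restrict (Set.uIoc 0 t)).prod μ) :=
    Integrable.of_bound (C := 2) hgm.aestronglyMeasurable (Eventually.of_forall hgb)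
  have hgi2 : Integrable (fun ω => ∫ s in (0 : ℝ)..t,
      (nbrAvg (occ (η s.toNNReal ω)) k - occ (η s.toNNReal ω) k)) μ := by
    have := hgi.integral_prod_right
    rw [Set.uIoc_of_le ht] at this
    simpa only [intervalIntegral.integral_of_le ht, Function.uncurry_apply_pair] using this
  rw [integral_sub (hη.integrable_occ t k) hgi2, ← intervalIntegral_integral_swap hgi] at h0
  have h1 : ∫ ω, occ (η 0 ω) k ∂μ = occ η₀ k := by
    rw [integral_congr_ae (g := fun _ => occ η₀ k)
      (hη.initial.mono fun ω h => by simp only [h])]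
    simp
  rw [h1] at h0
  have h2 : ∀ s : ℝ, ∫ ω, (nbrAvg (occ (η s.toNNReal ω)) k - occ (η s.toNNReal ω) k) ∂μ =
      nbrAvg (meanOcc μ η s) k - meanOcc μ η s k := fun s => by
    have hi : Integrable (fun ω => nbrAvg (occ (η s.toNNReal ω)) k) μ := by
      unfold nbrAvg
      exact (integrable_finsetSum _ fun i _ =>
        (hη.integrable_occ s _).add (hη.integrable_occ s _)).const_mul _
    rw [integral_sub hi (hη.integrable_occ s k), integral_nbrAvg (fun j => hη.integrable_occ s j)]
    rfl
  simp only [h2] at h0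
  unfold meanOcc at h0 ⊢
  linarith

end MeanOccupation

/-! ### The Poisson series for the mean occupation. -/

lemma nbrAvg_iterate_nonneg {d : ℕ} {f : Site d → ℝ} (hf : ∀ k, 0 ≤ f k) (N : ℕ) (k : Site d) :
    0 ≤ nbrAvg^[N] f k := by
  induction N generalizing k with
  | zero => exact hf k
  | succ N ih => rw [Function.iterate_succ_apply']; exact nbrAvg_nonneg ih k

lemma integral_pow_div_factorial (N : ℕ) (t : ℝ) :
    ∫ s in (0 : ℝ)..t, s ^ N / N.factorial = t ^ (N + 1) / (N + 1).factorial := by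
  rw [intervalIntegral.integral_div, integral_pow, Nat.factorial_succ]
  push_cast
  field_simp
  simp

section MeanOccupation

variable {d : ℕ} {Ω : Type*} {m : MeasurableSpace Ω} {μ : Measure Ω}
  {ℱ : Filtration ℝ≥0 m} {η : ℝ≥0 → Ω → Config d} {η₀ : Config d}

lemma IsSSEP.intervalIntegrable_meanOcc_drift [IsProbabilityMeasure μ] (hη : IsSSEP μ ℱ η η₀)
    (k : Site d) (a b : ℝ) :
    IntervalIntegrable (fun s => nbrAvg (meanOcc μ η s) k - meanOcc μ η s k) volume a b := by
  refine (intervalIntegrable_const (c := (2 : ℝ))).mono_fun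
    (((measurable_nbrAvg hη.measurable_meanOcc k).sub
      (hη.measurable_meanOcc k)).aestronglyMeasurable) (Eventually.of_forall fun s => ?_)
  have := abs_nbrAvg_le zero_le_one (hη.abs_meanOcc_le s) k
  simp only [Real.norm_eq_abs]
  rw [abs_of_pos (two_pos : (0 : ℝ) < 2)]
  linarith [abs_sub (nbrAvg (meanOcc μ η s) k) (meanOcc μ η s k), hη.abs_meanOcc_le s k]

/-- A bootstrap: the drift is so far only bounded and measurable, but its primitive is continuous.
This makes the drift itself continuous on [0, ∞) and allows differentiation in
`IsSSEP.hasDerivAt_meanOcc`. -/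
lemma IsSSEP.continuousOn_meanOcc [IsProbabilityMeasure μ] (hd : 0 < d) (hη : IsSSEP μ ℱ η η₀)
    (k : Site d) : ContinuousOn (fun t => meanOcc μ η t k) (Set.Ici 0) := by
  have := intervalIntegral.continuous_primitive (hη.intervalIntegrable_meanOcc_drift k) 0
  exact (continuous_const.add this).continuousOn.congr fun t ht => hη.meanOcc_eq hd ht k

lemma continuousOn_nbrAvg {f : ℝ → Site d → ℝ} {s : Set ℝ}
    (hf : ∀ k, ContinuousOn (fun x => f x k) s) (k : Site d) :
    ContinuousOn (fun x => nbrAvg (f x) k) s := by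
  unfold nbrAvg
  exact continuousOn_const.mul (continuousOn_finsetSum _ fun i _ => (hf _).add (hf _))

lemma IsSSEP.hasDerivAt_meanOcc [IsProbabilityMeasure μ] (hd : 0 < d) (hη : IsSSEP μ ℱ η η₀)
    (k : Site d) {t : ℝ} (ht : 0 < t) :
    HasDerivAt (fun t => meanOcc μ η t k) (nbrAvg (meanOcc μ η t) k - meanOcc μ η t k) t := by
  have hc : ContinuousOn (fun s => nbrAvg (meanOcc μ η s) k - meanOcc μ η s k) (Set.Ici 0) :=
    (continuousOn_nbrAvg (hη.continuousOn_meanOcc hd) k).sub (hη.continuousOn_meanOcc hd k)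
  have h1 := intervalIntegral.integral_hasDerivAt_right
    (hη.intervalIntegrable_meanOcc_drift k 0 t)
    (((measurable_nbrAvg hη.measurable_meanOcc k).sub
      (hη.measurable_meanOcc k)).stronglyMeasurable.stronglyMeasurableAtFilter)
    (hc.continuousAt (Ici_mem_nhds ht))
  refine (h1.const_add (occ η₀ k)).congr_of_eventuallyEq ?_
  filter_upwards [Ici_mem_nhds ht] with s hs
  exact hη.meanOcc_eq hd hs k

/-- The integrating factor e^t removes the loss term, leaving a pure neighbour average under the
integral, ready for Picard iteration. -/
lemma IsSSEP.exp_mul_meanOcc [IsProbabilityMeasure μ] (hd : 0 < d) (hη : IsSSEP μ ℱ η η₀)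
    (k : Site d) {t : ℝ} (ht : 0 ≤ t) :
    Real.exp t * meanOcc μ η t k = occ η₀ k +
      ∫ s in (0 : ℝ)..t, nbrAvg (fun j => Real.exp s * meanOcc μ η s j) k := by
  have hc : ∀ j, ContinuousOn (fun s => Real.exp s * meanOcc μ η s j) (Set.Ici 0) := fun j =>
    Real.continuous_exp.continuousOn.mul (hη.continuousOn_meanOcc hd j)
  have h := intervalIntegral.integral_eq_sub_of_hasDerivAt_of_le ht
    (f := fun s => Real.exp s * meanOcc μ η s k)
    (f' := fun s => nbrAvg (fun j => Real.exp s * meanOcc μ η s j) k)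
    ((hc k).mono Set.Icc_subset_Ici_self) (fun s hs => ?_) ?_
  · have h0 : meanOcc μ η 0 k = occ η₀ k := by simpa using hη.meanOcc_eq hd le_rfl k
    rw [h, h0]; simp
  · rw [nbrAvg_const_mul]
    exact ((Real.hasDerivAt_exp s).mul (hη.hasDerivAt_meanOcc hd k hs.1)).congr_deriv (by ring)
  · refine ContinuousOn.intervalIntegrable ?_
    rw [Set.uIcc_of_le ht]
    exact (continuousOn_nbrAvg hc k).mono Set.Icc_subset_Ici_self

/-- The remainder after N + 1 terms is the time integral of the neighbour average of the remainder
after N terms. As `nbrAvg` does not increase the supremum norm, each round gains one factor in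
t^N/N!. -/
lemma IsSSEP.abs_exp_mul_meanOcc_sub_le [IsProbabilityMeasure μ] (hd : 0 < d)
    (hη : IsSSEP μ ℱ η η₀) (N : ℕ) (k : Site d) {t : ℝ} (ht : 0 ≤ t) :
    |Real.exp t * meanOcc μ η t k -
      ∑ j ∈ Finset.range N, t ^ j / j.factorial * nbrAvg^[j] (occ η₀) k| ≤
      Real.exp t * (t ^ N / N.factorial) := by
  induction N generalizing k t with
  | zero =>
    simp only [Finset.range_zero, Finset.sum_empty, sub_zero, abs_mul, Real.abs_exp, pow_zero,
      Nat.factorial_zero, Nat.cast_one, div_one]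
    gcongr
    exact hη.abs_meanOcc_le t k
  | succ N ih =>
    have hc : ∀ j, ContinuousOn (fun s => Real.exp s * meanOcc μ η s j) (Set.uIcc 0 t) := fun j =>
      Real.continuous_exp.continuousOn.mul ((hη.continuousOn_meanOcc hd j).mono
        (by rw [Set.uIcc_of_le ht]; exact Set.Icc_subset_Ici_self))
    have key : Real.exp t * meanOcc μ η t k -
        ∑ j ∈ Finset.range (N + 1), t ^ j / j.factorial * nbrAvg^[j] (occ η₀) k =
        ∫ s in (0 : ℝ)..t, nbrAvg (fun l => Real.exp s * meanOcc μ η s l -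
          ∑ j ∈ Finset.range N, s ^ j / j.factorial * nbrAvg^[j] (occ η₀) l) k := by
      simp only [nbrAvg_sub, nbrAvg_finset_sum, nbrAvg_const_mul]
      rw [intervalIntegral.integral_sub, hη.exp_mul_meanOcc hd k ht,
        intervalIntegral.integral_finsetSum, Finset.sum_range_succ']
      · simp only [intervalIntegral.integral_mul_const, integral_pow_div_factorial,
          Function.iterate_succ_apply', nbrAvg_const_mul]
        simp only [pow_zero, Nat.factorial_zero, Nat.cast_one, div_one, one_mul,
          Function.iterate_zero, id_eq]
        ring
      · intro j _
        exact Continuous.intervalIntegrable (by fun_prop) _ _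
      · have := (continuousOn_nbrAvg hc k).intervalIntegrable (μ := volume)
        simpa only [nbrAvg_const_mul] using this
      · refine Continuous.intervalIntegrable ?_ _ _
        exact continuous_finsetSum _ fun j _ => by fun_prop
    rw [key, ← Real.norm_eq_abs]
    calc _ ≤ ∫ s in (0 : ℝ)..t, Real.exp t * (s ^ N / N.factorial) := by
          refine intervalIntegral.norm_integral_le_of_norm_le ht
            (Eventually.of_forall fun s hs => ?_)
            (Continuous.intervalIntegrable (by fun_prop) _ _)
          refine abs_nbrAvg_le (by have := hs.1; positivity) (fun l => ?_) k
          refine (ih l hs.1.le).trans ?_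
          have := hs.1
          gcongr
          exact hs.2
      _ = _ := by
          rw [intervalIntegral.integral_const_mul, integral_pow_div_factorial]

lemma IsSSEP.hasSum_meanOcc [IsProbabilityMeasure μ] (hd : 0 < d) (hη : IsSSEP μ ℱ η η₀)
    (k : Site d) {t : ℝ} (ht : 0 ≤ t) :
    HasSum (fun N : ℕ => Real.exp (-t) * (t ^ N / N.factorial) * nbrAvg^[N] (occ η₀) k)
      (meanOcc μ η t k) := by
  have h1 : HasSum (fun N : ℕ => t ^ N / N.factorial * nbrAvg^[N] (occ η₀) k)
      (Real.exp t * meanOcc μ η t k) := by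
    rw [hasSum_iff_tendsto_nat_of_nonneg fun N => mul_nonneg (by positivity)
      (nbrAvg_iterate_nonneg (occ_nonneg η₀) N k)]
    rw [tendsto_iff_norm_sub_tendsto_zero]
    have h2 := ((FloorSemiring.tendsto_pow_div_factorial_atTop t).const_mul (Real.exp t))
    rw [mul_zero] at h2
    refine squeeze_zero (fun _ => norm_nonneg _) (fun N => ?_) h2
    rw [norm_sub_rev]
    exact hη.abs_exp_mul_meanOcc_sub_le hd N k ht
  have h2 := h1.mul_left (Real.exp (-t))
  rw [← mul_assoc (Real.exp (-t)), ← Real.exp_add, neg_add_cancel, Real.exp_zero, one_mul] at h2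
  simpa only [mul_assoc] using h2

end MeanOccupation

/-! ### Projection to the first coordinate. -/

lemma cons_add_e_zero {n : ℕ} (p : ℤ) (k : Site n) :
    (Fin.cons p k : Site (n + 1)) + e 0 = Fin.cons (p + 1) k := by
  ext i
  refine Fin.cases ?_ (fun j => ?_) i
  · simp [e]
  · simp [e]

lemma cons_sub_e_zero {n : ℕ} (p : ℤ) (k : Site n) :
    (Fin.cons p k : Site (n + 1)) - e 0 = Fin.cons (p - 1) k := by
  rw [sub_eq_iff_eq_add, cons_add_e_zero, sub_add_cancel]

lemma cons_add_e_succ {n : ℕ} (p : ℤ) (k : Site n) (i : Fin n) :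
    (Fin.cons p k : Site (n + 1)) + e i.succ = Fin.cons p (k + e i) := by
  ext j
  refine Fin.cases ?_ (fun j => ?_) j
  · simp [e, (Fin.succ_ne_zero i).symm]
  · simp [e, Pi.single_apply, Fin.succ_inj]

lemma cons_sub_e_succ {n : ℕ} (p : ℤ) (k : Site n) (i : Fin n) :
    (Fin.cons p k : Site (n + 1)) - e i.succ = Fin.cons p (k - e i) := by
  rw [sub_eq_iff_eq_add, cons_add_e_succ, sub_add_cancel]

/-- The total mass of `f` on the hyperplane of sites with first coordinate `p`. -/
def fiberMass {n : ℕ} (f : Site (n + 1) → ℝ) (p : ℤ) : ℝ≥0∞ :=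
  ∑' k : Site n, ENNReal.ofReal (f (Fin.cons p k))

/-- Steps inside a hyperplane preserve its mass by translation invariance, so the projection is a
lazy walk that stays put with probability n/(n+1). Values in `ℝ≥0∞` make every rearrangement free.
-/
lemma fiberMass_nbrAvg {n : ℕ} {f : Site (n + 1) → ℝ} (hf : ∀ k, 0 ≤ f k) (p : ℤ) :
    fiberMass (nbrAvg f) p = ENNReal.ofReal (n / (n + 1)) * fiberMass f p +
      ENNReal.ofReal (1 / (2 * (n + 1))) * (fiberMass f (p - 1) + fiberMass f (p + 1)) := by
  have h1 : ∀ k : Site n, ENNReal.ofReal (nbrAvg f (Fin.cons p k)) =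
      ENNReal.ofReal (1 / (2 * (n + 1))) *
        (ENNReal.ofReal (f (Fin.cons (p + 1) k)) + ENNReal.ofReal (f (Fin.cons (p - 1) k)) +
          ∑ i : Fin n, (ENNReal.ofReal (f (Fin.cons p (k + e i))) +
            ENNReal.ofReal (f (Fin.cons p (k - e i))))) := fun k => by
    rw [nbrAvg, Fin.sum_univ_succ, ENNReal.ofReal_mul (by positivity),
      cons_add_e_zero, cons_sub_e_zero,
      ENNReal.ofReal_add (add_nonneg (hf _) (hf _))
        (Finset.sum_nonneg fun i _ => add_nonneg (hf _) (hf _)),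
      ENNReal.ofReal_add (hf _) (hf _),
      ENNReal.ofReal_sum_of_nonneg fun i _ => add_nonneg (hf _) (hf _)]
    simp only [cons_add_e_succ, cons_sub_e_succ, ENNReal.ofReal_add (hf _) (hf _)]
    push_cast
    rfl
  have h2 : ∀ i : Fin n, ∑' k : Site n, ENNReal.ofReal (f (Fin.cons p (k + e i))) =
      fiberMass f p := fun i =>
    (Equiv.addRight (e i)).tsum_eq fun k : Site n => ENNReal.ofReal (f (Fin.cons p k))
  have h3 : ∀ i : Fin n, ∑' k : Site n, ENNReal.ofReal (f (Fin.cons p (k - e i))) =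
      fiberMass f p := fun i =>
    (Equiv.subRight (e i)).tsum_eq fun k : Site n => ENNReal.ofReal (f (Fin.cons p k))
  have h4 : ENNReal.ofReal (n / (n + 1)) = ENNReal.ofReal (1 / (2 * (n + 1))) * (n * 2) := by
    rw [← ENNReal.ofReal_natCast, ← ENNReal.ofReal_ofNat 2, ← ENNReal.ofReal_mul (by positivity),
      ← ENNReal.ofReal_mul (by positivity)]
    congr 1
    field_simp
  rw [fiberMass, tsum_congr h1, ENNReal.tsum_mul_left, ENNReal.tsum_add, ENNReal.tsum_add,
    Summable.tsum_finsetSum fun _ _ => ENNReal.summable]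
  simp only [ENNReal.tsum_add, h2, h3]
  rw [h4, Finset.sum_const, Finset.card_univ, Fintype.card_fin, nsmul_eq_mul]
  simp only [fiberMass]
  ring

/-- The law after `N` steps of the first coordinate of simple random walk on `ℤ^(n+1)`. -/
def walkLaw (n : ℕ) : ℕ → ℤ → ℝ
  | 0 => fun j => if j = 0 then 1 else 0
  | N + 1 => fun j => n / (n + 1) * walkLaw n N j +
      1 / (2 * (n + 1)) * (walkLaw n N (j - 1) + walkLaw n N (j + 1))

lemma walkLaw_nonneg (n N : ℕ) (j : ℤ) : 0 ≤ walkLaw n N j := by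
  induction N generalizing j with
  | zero => unfold walkLaw; split_ifs <;> norm_num
  | succ N ih =>
    have h1 := ih j
    have h2 := ih (j - 1)
    have h3 := ih (j + 1)
    unfold walkLaw
    positivity

lemma walkLaw_le_one (n N : ℕ) (j : ℤ) : walkLaw n N j ≤ 1 := by
  induction N generalizing j with
  | zero => unfold walkLaw; split_ifs <;> norm_num
  | succ N ih =>
    unfold walkLaw
    calc _ ≤ (n : ℝ) / (n + 1) * 1 + 1 / (2 * (n + 1)) * (1 + 1) := by
          gcongr <;> apply ih
      _ = 1 := by field_simp; ring

/-- Both sides obey the same recursion in N. Because `walkLaw n 0` is the Kronecker delta, `hG` says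
that f has mass G u on the hyperplane at -u and none on positive hyperplanes. -/
lemma fiberMass_nbrAvg_iterate {n : ℕ} {f : Site (n + 1) → ℝ} (hf : ∀ k, 0 ≤ f k)
    {G : ℕ → ℝ≥0∞} (hG : ∀ p, fiberMass f p = ∑' u : ℕ, ENNReal.ofReal (walkLaw n 0 (p + u)) * G u)
    (N : ℕ) (p : ℤ) :
    fiberMass (nbrAvg^[N] f) p = ∑' u : ℕ, ENNReal.ofReal (walkLaw n N (p + u)) * G u := by
  induction N generalizing p with
  | zero => exact hG p
  | succ N ih =>
    rw [Function.iterate_succ_apply', fiberMass_nbrAvg (nbrAvg_iterate_nonneg hf N), ih, ih, ih,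
      ← ENNReal.tsum_add, ← ENNReal.tsum_mul_left, ← ENNReal.tsum_mul_left, ← ENNReal.tsum_add]
    refine tsum_congr fun u => ?_
    have h1 := walkLaw_nonneg n N (p + u)
    have h2 := walkLaw_nonneg n N (p + u - 1)
    have h3 := walkLaw_nonneg n N (p + u + 1)
    rw [walkLaw, ENNReal.ofReal_add (by positivity) (by positivity),
      ENNReal.ofReal_mul (by positivity), ENNReal.ofReal_mul (by positivity),
      ENNReal.ofReal_add h2 h3, show p - 1 + (u : ℤ) = p + u - 1 by ring,
      show p + 1 + (u : ℤ) = p + u + 1 by ring]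
    ring

/-- The law at time `t` of the first coordinate of continuous-time simple random walk. -/
def heatKernel (n : ℕ) (t : ℝ) (j : ℤ) : ℝ :=
  ∑' N : ℕ, Real.exp (-t) * (t ^ N / N.factorial) * walkLaw n N j

lemma summable_heatKernel (n : ℕ) {t : ℝ} (ht : 0 ≤ t) (j : ℤ) :
    Summable fun N : ℕ => Real.exp (-t) * (t ^ N / N.factorial) * walkLaw n N j := by
  refine Summable.of_nonneg_of_le
    (fun N => mul_nonneg (by positivity) (walkLaw_nonneg n N j)) (fun N => ?_)
    ((Real.summable_pow_div_factorial t).mul_left (Real.exp (-t)))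
  exact mul_le_of_le_one_right (by positivity) (walkLaw_le_one n N j)

/-- The sites with first coordinate above `z`, as a product. -/
def aboveEquiv (n : ℕ) (z : ℝ) : ℕ × Site n ≃ {k : Site (n + 1) // z < (k 0 : ℝ)} where
  toFun q := ⟨Fin.cons (⌊z⌋ + 1 + q.1) q.2, by
    have := Int.lt_floor_add_one z
    simp only [Fin.cons_zero]
    push_cast
    have h : (0 : ℝ) ≤ q.1 := by positivity
    linarith⟩
  invFun k := ((k.1 0 - (⌊z⌋ + 1)).toNat, Fin.tail k.1)
  left_inv q := by
    ext <;> simp [Fin.tail]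
  right_inv k := by
    have h : ⌊z⌋ + 1 ≤ k.1 0 := by
      have := Int.floor_lt.2 k.2
      omega
    ext i
    refine Fin.cases ?_ (fun j => ?_) i
    · simp only [Fin.cons_zero]
      rw [Int.toNat_of_nonneg (by omega)]
      ring
    · simp [Fin.tail]

/-- Tonelli throughout: j is the height above the lowest integer exceeding z, u the initial depth,
so the walk must travel ⌊z⌋ + 1 + j + u. -/
lemma lintegral_numAbove {n : ℕ} {Ω : Type*} {m : MeasurableSpace Ω} {μ : Measure Ω}
    [IsProbabilityMeasure μ] {ℱ : Filtration ℝ≥0 m} {η : ℝ≥0 → Ω → Config (n + 1)}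
    {η₀ : Config (n + 1)} (hη : IsSSEP μ ℱ η η₀) {G : ℕ → ℝ≥0∞}
    (hG : ∀ p, fiberMass (occ η₀) p = ∑' u : ℕ, ENNReal.ofReal (walkLaw n 0 (p + u)) * G u)
    (z : ℝ) (t : ℝ≥0) :
    ∫⁻ ω, numAbove z (η t ω) ∂μ =
      ∑' j : ℕ, ∑' u : ℕ, ENNReal.ofReal (heatKernel n t (⌊z⌋ + 1 + j + u)) * G u := by
  have hocc : ∀ (ξ : Config (n + 1)) k, (if ξ k then (1 : ℝ≥0∞) else 0) =
      ENNReal.ofReal (occ ξ k) := fun ξ k => by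
    unfold occ; split_ifs <;> simp
  have hm : ∀ k, Measurable fun ω => ENNReal.ofReal (occ (η t ω) k) := fun k =>
    ((measurable_occ k).comp ((hη.adapted t).mono (ℱ.le t) le_rfl)).ennreal_ofReal
  have hmean : ∀ k, ∫⁻ ω, ENNReal.ofReal (occ (η t ω) k) ∂μ =
      ∑' N : ℕ, ENNReal.ofReal (Real.exp (-t) * ((t : ℝ) ^ N / N.factorial)) *
        ENNReal.ofReal (nbrAvg^[N] (occ η₀) k) := fun k => by
    have h1 := hη.integrable_occ t k
    have h2 := hη.hasSum_meanOcc n.succ_pos k t.coe_nonneg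
    rw [Real.toNNReal_coe] at h1
    rw [← ofReal_integral_eq_lintegral_ofReal h1 (Eventually.of_forall fun _ => occ_nonneg _ _)]
    have h3 : ∫ ω, occ (η t ω) k ∂μ = meanOcc μ η t k := by
      rw [meanOcc, Real.toNNReal_coe]
    have hnn := nbrAvg_iterate_nonneg (occ_nonneg η₀)
    rw [h3, ← h2.tsum_eq, ENNReal.ofReal_tsum_of_nonneg _ h2.summable]
    · exact tsum_congr fun N => ENNReal.ofReal_mul (by positivity)
    · exact fun N => mul_nonneg (by positivity) (hnn N k)
  simp only [numAbove, hocc]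
  rw [lintegral_tsum fun k : {k : Site (n + 1) // z < (k 0 : ℝ)} => (hm k.1).aemeasurable]
  simp only [hmean]
  rw [← (aboveEquiv n z).tsum_eq, ENNReal.tsum_prod']
  refine tsum_congr fun j => ?_
  rw [ENNReal.tsum_comm]
  have h5 : ∀ N : ℕ, ∑' k : Site n,
      ENNReal.ofReal (Real.exp (-t) * ((t : ℝ) ^ N / N.factorial)) *
        ENNReal.ofReal (nbrAvg^[N] (occ η₀) ((aboveEquiv n z) (j, k)).1) =
      ∑' u : ℕ, ENNReal.ofReal (Real.exp (-t) * ((t : ℝ) ^ N / N.factorial) *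
        walkLaw n N (⌊z⌋ + 1 + j + u)) * G u := fun N => by
    rw [ENNReal.tsum_mul_left]
    change _ * fiberMass (nbrAvg^[N] (occ η₀)) (⌊z⌋ + 1 + j) = _
    rw [fiberMass_nbrAvg_iterate (occ_nonneg η₀) hG, ← ENNReal.tsum_mul_left]
    refine tsum_congr fun u => ?_
    have hp : 0 ≤ Real.exp (-t) * ((t : ℝ) ^ N / N.factorial) := by positivity
    rw [ENNReal.ofReal_mul hp, mul_assoc]
  rw [tsum_congr h5, ENNReal.tsum_comm]
  refine tsum_congr fun u => ?_
  rw [ENNReal.tsum_mul_right, heatKernel,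
    ENNReal.ofReal_tsum_of_nonneg _ (summable_heatKernel n t.coe_nonneg _)]
  exact fun N => mul_nonneg (by positivity) (walkLaw_nonneg _ _ _)

/-! ### Hyperplane masses of the initial profile. -/

/-- The number of initially occupied sites at depth `u`, for shape functions `g`. -/
def crossSection {n : ℕ} (g : Fin n → ℝ → ℝ) (u : ℝ) : ℝ := ∏ i, (2 * (⌊g i u⌋ : ℝ) + 1)

lemma fiberMass_profile {n : ℕ} {g : Fin n → ℝ → ℝ} (hg : ∀ i (u : ℕ), 0 ≤ g i u) (p : ℤ) :
    fiberMass (occ (profile g)) p =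
      ∑' u : ℕ, ENNReal.ofReal (walkLaw n 0 (p + u)) * ENNReal.ofReal (crossSection g u) := by
  have hw : ∀ j, walkLaw n 0 j = if j = 0 then 1 else 0 := fun j => rfl
  simp only [hw, fiberMass, occ, profile, Fin.cons_zero, Fin.cons_succ, decide_eq_true_eq]
  by_cases hp : p ≤ 0
  · obtain ⟨v, rfl⟩ : ∃ v : ℕ, p = -v := ⟨p.natAbs, by omega⟩
    rw [tsum_eq_single v fun u hu => by
      rw [if_neg, ENNReal.ofReal_zero, zero_mul]
      omega]
    let A : Finset (Site n) := Fintype.piFinset fun i => Finset.Icc (-⌊g i v⌋) ⌊g i v⌋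
    have hA : ∀ k : Site n, (-(v : ℤ) ≤ 0 ∧ ∀ i, |(k i : ℝ)| ≤ g i (-((-(v : ℤ) : ℤ) : ℝ))) ↔
        k ∈ A := fun k => by
      simp only [A, Fintype.mem_piFinset, Finset.mem_Icc, hp, true_and]
      refine forall_congr' fun i => ?_
      push_cast
      rw [neg_neg, ← abs_le, Int.le_floor]
      push_cast
      rfl
    simp only [hA]
    rw [tsum_eq_sum (s := A) fun k hk => by simp [hk]]
    rw [Finset.sum_congr rfl fun k hk => by rw [if_pos hk]]
    have hcard : ((A.card : ℕ) : ℝ) = crossSection g v := by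
      simp only [A, Fintype.card_piFinset, crossSection, Nat.cast_prod, Int.card_Icc]
      refine Finset.prod_congr rfl fun i _ => ?_
      have : 0 ≤ ⌊g i v⌋ := Int.floor_nonneg.2 (hg i v)
      have h2 : (((⌊g i v⌋ + 1 - -⌊g i v⌋).toNat : ℤ) : ℝ) = 2 * (⌊g i v⌋ : ℝ) + 1 := by
        rw [Int.toNat_of_nonneg (by omega)]
        push_cast; ring
      exact_mod_cast h2
    rw [← hcard]
    simp
  · have : ∀ u : ℕ, p + u ≠ 0 := fun u => by omega
    simp [hp, this]

/-! ### Fourier representation of the heat kernel on a shifted line. -/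

/-- The multiplier of one step of the first coordinate of simple random walk on `ℤ^(n+1)`. -/
def stepMult (n : ℕ) (w : ℂ) : ℂ := n / (n + 1) + 1 / (n + 1) * Complex.cosh w

lemma continuous_stepMult (n : ℕ) : Continuous (stepMult n) := by
  unfold stepMult
  fun_prop

/-- Orthogonality of characters, unaffected by the real shift θ. Here `walkLaw 0 0` serves only as a
Kronecker delta; it agrees with `walkLaw n 0` for every n. -/
lemma integral_exp_neg_int_mul (j : ℤ) (θ : ℝ) :
    ∫ s in (-Real.pi)..Real.pi, Complex.exp (-j * (θ + s * Complex.I)) =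
      (walkLaw 0 0 j : ℂ) * (2 * Real.pi) := by
  by_cases hj : j = 0
  · subst hj
    simp [walkLaw]
    ring
  · have hc : (-j * Complex.I : ℂ) ≠ 0 := by
      simp [hj]
    have h1 : ∀ s : ℝ, Complex.exp (-j * (θ + s * Complex.I)) =
        Complex.exp (-j * θ) * Complex.exp ((-j * Complex.I) * s) := fun s => by
      rw [← Complex.exp_add]; ring_nf
    simp only [h1]
    rw [intervalIntegral.integral_const_mul, integral_exp_mul_complex hc]
    have h2 : Complex.exp ((-j * Complex.I) * (Real.pi : ℝ)) =
        Complex.exp ((-j * Complex.I) * ((-Real.pi : ℝ) : ℝ)) := by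
      rw [Complex.exp_eq_exp_iff_exists_int]
      refine ⟨-j, ?_⟩
      push_cast
      ring
    rw [h2, sub_self]
    simp [walkLaw, hj]

/-- Induction on N proves the inversion formula for all θ at once, so no contour has to be moved. -/
lemma walkLaw_mul_two_pi (n N : ℕ) (j : ℤ) (θ : ℝ) :
    (walkLaw n N j : ℂ) * (2 * Real.pi) = ∫ s in (-Real.pi)..Real.pi,
      Complex.exp (-j * (θ + s * Complex.I)) * stepMult n (θ + s * Complex.I) ^ N := by
  induction N generalizing j with
  | zero =>
    simp only [pow_zero, mul_one, integral_exp_neg_int_mul]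
    rfl
  | succ N ih =>
    have hint : ∀ (i : ℤ), IntervalIntegrable (fun s : ℝ =>
        Complex.exp (-i * (θ + s * Complex.I)) * stepMult n (θ + s * Complex.I) ^ N)
        volume (-Real.pi) Real.pi := fun i => by
      have := continuous_stepMult n
      exact Continuous.intervalIntegrable (by fun_prop) _ _
    have h1 : ∀ s : ℝ, Complex.exp (-j * (θ + s * Complex.I)) *
        stepMult n (θ + s * Complex.I) ^ (N + 1) =
        (n / (n + 1) : ℂ) * (Complex.exp (-j * (θ + s * Complex.I)) *
          stepMult n (θ + s * Complex.I) ^ N) +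
        (1 / (2 * (n + 1)) : ℂ) * (Complex.exp (-(j - 1 : ℤ) * (θ + s * Complex.I)) *
          stepMult n (θ + s * Complex.I) ^ N + Complex.exp (-(j + 1 : ℤ) * (θ + s * Complex.I)) *
          stepMult n (θ + s * Complex.I) ^ N) := fun s => by
      generalize (θ + s * Complex.I : ℂ) = w
      have e1 : Complex.exp (-(j - 1 : ℤ) * w) = Complex.exp (-j * w) * Complex.exp w := by
        rw [← Complex.exp_add]; push_cast; ring_nf
      have e2 : Complex.exp (-(j + 1 : ℤ) * w) = Complex.exp (-j * w) * Complex.exp (-w) := by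
        rw [← Complex.exp_add]; push_cast; ring_nf
      have hn : (n + 1 : ℂ) ≠ 0 := Nat.cast_add_one_ne_zero n
      have e3 : stepMult n w = n / (n + 1) +
          1 / (2 * (n + 1)) * (Complex.exp w + Complex.exp (-w)) := by
        rw [stepMult, Complex.cosh]; field_simp
      rw [e1, e2, pow_succ]
      nth_rewrite 2 [e3]
      ring
    simp only [h1]
    rw [intervalIntegral.integral_add ((hint j).const_mul _)
      (((hint _).add (hint _)).const_mul _), intervalIntegral.integral_const_mul,
      intervalIntegral.integral_const_mul, intervalIntegral.integral_add (hint _) (hint _),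
      ← ih, ← ih, ← ih]
    simp only [walkLaw]
    push_cast
    ring

lemma norm_cosh_le (w : ℂ) : ‖Complex.cosh w‖ ≤ Real.cosh w.re := by
  rw [Complex.cosh, norm_div, Complex.norm_ofNat, Real.cosh_eq]
  gcongr
  refine (norm_add_le _ _).trans ?_
  simp [Complex.norm_exp]

lemma norm_stepMult_le (n : ℕ) (w : ℂ) : ‖stepMult n w‖ ≤ Real.cosh w.re := by
  have h1 := Real.one_le_cosh w.re
  have hn : ‖(n + 1 : ℂ)‖ = n + 1 := by exact_mod_cast Complex.norm_natCast (n + 1)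
  unfold stepMult
  calc _ ≤ (n : ℝ) / (n + 1) + 1 / (n + 1) * Real.cosh w.re := by
        refine (norm_add_le _ _).trans ?_
        rw [norm_mul, norm_div, norm_div, hn, Complex.norm_natCast, norm_one]
        gcongr
        exact norm_cosh_le w
    _ ≤ (n : ℝ) / (n + 1) * Real.cosh w.re + 1 / (n + 1) * Real.cosh w.re := by
        gcongr
        exact le_mul_of_one_le_right (by positivity) h1
    _ = _ := by field_simp

lemma heatKernel_mul_two_pi (n : ℕ) {t : ℝ} (ht : 0 ≤ t) (j : ℤ) (θ : ℝ) :
    (heatKernel n t j : ℂ) * (2 * Real.pi) = ∫ s in (-Real.pi)..Real.pi,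
      Complex.exp (-j * (θ + s * Complex.I)) *
        Complex.exp ((t / (n + 1) : ℝ) * (Complex.cosh (θ + s * Complex.I) - 1)) := by
  have h1 : HasSum (fun N : ℕ => ((Real.exp (-t) * (t ^ N / N.factorial) * walkLaw n N j : ℝ) : ℂ) *
      (2 * Real.pi)) ((heatKernel n t j : ℂ) * (2 * Real.pi)) :=
    (Complex.hasSum_ofReal.2 (summable_heatKernel n ht j).hasSum).mul_right _
  have h2 : ∀ N : ℕ, ((Real.exp (-t) * (t ^ N / N.factorial) * walkLaw n N j : ℝ) : ℂ) *
      (2 * Real.pi) = ∫ s in (-Real.pi)..Real.pi, Complex.exp (-t) *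
        Complex.exp (-j * (θ + s * Complex.I)) *
        ((t * stepMult n (θ + s * Complex.I)) ^ N / N.factorial) := fun N => by
    have : ∀ s : ℝ, Complex.exp (-t) * Complex.exp (-j * (θ + s * Complex.I)) *
        ((t * stepMult n (θ + s * Complex.I)) ^ N / N.factorial) =
        (Complex.exp (-t) * (t ^ N / N.factorial)) * (Complex.exp (-j * (θ + s * Complex.I)) *
          stepMult n (θ + s * Complex.I) ^ N) := fun s => by
      rw [mul_pow]; ring
    simp only [this]
    rw [intervalIntegral.integral_const_mul, ← walkLaw_mul_two_pi]
    push_cast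
    ring
  simp only [h2] at h1
  -- Since |`stepMult`| ≤ cosh θ on the line, the terms are dominated by an exponential series that
  -- does not depend on s.
  refine h1.unique (intervalIntegral.hasSum_integral_of_dominated_convergence
    (fun N _ => Real.exp (-t) * Real.exp (-j * θ) * ((t * Real.cosh θ) ^ N / N.factorial))
    (fun N => ?_) (fun N => ?_) ?_ ?_ ?_)
  · have := continuous_stepMult n
    exact Continuous.aestronglyMeasurable (by fun_prop)
  · refine Eventually.of_forall fun s _ => ?_
    have hre : ((θ : ℂ) + s * Complex.I).re = θ := by simp
    have hre2 : (-(j : ℂ) * (θ + s * Complex.I)).re = -j * θ := by simp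
    have hs := norm_stepMult_le n (θ + s * Complex.I)
    rw [hre] at hs
    rw [norm_mul, norm_mul, norm_div, norm_pow, norm_mul, Complex.norm_exp, Complex.norm_exp, hre2,
      Complex.norm_natCast, Complex.norm_real, Real.norm_of_nonneg ht, Complex.neg_re,
      Complex.ofReal_re]
    gcongr
  · exact Eventually.of_forall fun s _ => (Real.summable_pow_div_factorial _).mul_left _
  · exact intervalIntegrable_const
  · refine Eventually.of_forall fun s _ => ?_
    have h3 := (NormedSpace.expSeries_div_hasSum_exp
      ((t : ℂ) * stepMult n (θ + s * Complex.I))).mul_left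
      (Complex.exp (-t) * Complex.exp (-j * (θ + s * Complex.I)))
    rw [← Complex.exp_eq_exp_ℂ] at h3
    have h4 : Complex.exp (-j * (θ + s * Complex.I)) *
        Complex.exp ((t / (n + 1) : ℝ) * (Complex.cosh (θ + s * Complex.I) - 1)) =
        Complex.exp (-t) * Complex.exp (-j * (θ + s * Complex.I)) *
          Complex.exp (t * stepMult n (θ + s * Complex.I)) := by
      simp only [← Complex.exp_add]
      congr 1
      have hn : (n + 1 : ℂ) ≠ 0 := Nat.cast_add_one_ne_zero n
      rw [stepMult]
      push_cast
      field_simp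
      ring
    rw [h4]
    exact h3

/-- The Fourier integral of the law of a continuous-time walk, after exponential tilting by `θ`. -/
def tiltedIntegral (τ θ a : ℝ) : ℝ :=
  ∫ s in (-Real.pi)..Real.pi, Real.exp (τ * Real.cosh θ * (Real.cos s - 1)) *
    Real.cos (τ * Real.sinh θ * Real.sin s - a * s)

/-- The prefactor is the integrand at s = 0, which is the Chernoff weight for the tilt θ; the rest
is oscillatory, and its real part suffices because the kernel is real. -/
lemma heatKernel_eq (n : ℕ) {t : ℝ} (ht : 0 ≤ t) (j : ℤ) (θ : ℝ) :
    heatKernel n t j = Real.exp (t / (n + 1) * (Real.cosh θ - 1) - j * θ) *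
      (tiltedIntegral (t / (n + 1)) θ j / (2 * Real.pi)) := by
  have h1 := heatKernel_mul_two_pi n ht j θ
  set τ := t / (n + 1)
  have h2 : ∀ s : ℝ, Complex.exp (-j * (θ + s * Complex.I)) *
      Complex.exp ((τ : ℝ) * (Complex.cosh (θ + s * Complex.I) - 1)) =
      (Real.exp (τ * (Real.cosh θ - 1) - j * θ) : ℝ) * (
        (Real.exp (τ * Real.cosh θ * (Real.cos s - 1)) : ℝ) * Complex.exp
          ((τ * Real.sinh θ * Real.sin s - j * s : ℝ) * Complex.I)) := fun s => by
    rw [Complex.ofReal_exp, Complex.ofReal_exp, ← Complex.exp_add, ← Complex.exp_add,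
      ← Complex.exp_add, Complex.cosh_add, Complex.cosh_mul_I, Complex.sinh_mul_I]
    push_cast
    ring_nf
  simp only [h2] at h1
  rw [intervalIntegral.integral_const_mul] at h1
  have hint : IntervalIntegrable (fun s : ℝ =>
      (Real.exp (τ * Real.cosh θ * (Real.cos s - 1)) : ℂ) * Complex.exp
          ((τ * Real.sinh θ * Real.sin s - j * s : ℝ) * Complex.I)) volume
      (-Real.pi) Real.pi :=
    Continuous.intervalIntegrable (by fun_prop) _ _
  have h3 : (∫ s in (-Real.pi)..Real.pi, (Real.exp (τ * Real.cosh θ * (Real.cos s - 1)) : ℂ) *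
      Complex.exp ((τ * Real.sinh θ * Real.sin s - j * s : ℝ) * Complex.I)).re =
      tiltedIntegral τ θ j := by
    have := Complex.reCLM.intervalIntegral_comp_comm hint
    simp only [Complex.reCLM_apply] at this
    rw [← this, tiltedIntegral]
    refine intervalIntegral.integral_congr fun s _ => ?_
    simp only [Complex.re_ofReal_mul, Complex.exp_ofReal_mul_I_re]
  rw [show ((heatKernel n t j : ℂ) * (2 * Real.pi)) =
    ((heatKernel n t j * (2 * Real.pi) : ℝ) : ℂ) by push_cast; ring] at h1
  have h4 := congrArg Complex.re h1
  rw [Complex.ofReal_re, Complex.re_ofReal_mul, h3] at h4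
  rw [← mul_div_assoc, ← h4]
  have := Real.pi_pos
  field_simp

/-! ### A local limit theorem under exponential tilting. -/

lemma abs_sinh_sub_self_le {x : ℝ} (hx : |x| ≤ 1) : |Real.sinh x - x| ≤ |x| ^ 3 := by
  have h1 := Real.exp_bound hx (n := 3) (by norm_num)
  have h2 := Real.exp_bound (x := -x) (by rwa [abs_neg]) (n := 3) (by norm_num)
  simp only [Finset.sum_range_succ, Finset.range_zero, Finset.sum_empty, Nat.factorial,
    abs_neg] at h1 h2
  norm_num at h1 h2
  have h3 : 0 ≤ |x| ^ 3 := by positivity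
  rw [Real.sinh_eq, abs_le]
  rw [abs_le] at h1 h2
  constructor <;> linarith [h1.1, h1.2, h2.1, h2.2]

lemma abs_cosh_sub_le {x : ℝ} (hx : |x| ≤ 1) : |Real.cosh x - 1 - x ^ 2 / 2| ≤ |x| ^ 4 := by
  have h1 := Real.exp_bound hx (n := 4) (by norm_num)
  have h2 := Real.exp_bound (x := -x) (by rwa [abs_neg]) (n := 4) (by norm_num)
  simp only [Finset.sum_range_succ, Finset.range_zero, Finset.sum_empty, Nat.factorial,
    abs_neg] at h1 h2
  norm_num at h1 h2
  have h3 : 0 ≤ |x| ^ 4 := by positivity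
  have h4 : (-x) ^ 3 = -x ^ 3 := by ring
  rw [h4] at h2
  rw [Real.cosh_eq, abs_le]
  rw [abs_le] at h1 h2
  constructor <;> linarith [h1.1, h1.2, h2.1, h2.2]

lemma abs_sin_sub_self_le {x : ℝ} (hx : |x| ≤ 1) : |Real.sin x - x| ≤ |x| ^ 3 := by
  have h1 := Real.sin_bound hx
  have h2 : |x| ^ 5 ≤ |x| ^ 3 := pow_le_pow_of_le_one (abs_nonneg _) hx (by norm_num)
  have h3 : |x ^ 3 / 6| = |x| ^ 3 / 6 := by rw [abs_div, abs_pow]; norm_num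
  have h5 : 0 ≤ |x| ^ 3 := by positivity
  calc |Real.sin x - x| = |(Real.sin x - (x - x ^ 3 / 6)) - x ^ 3 / 6| := by ring_nf
    _ ≤ |Real.sin x - (x - x ^ 3 / 6)| + |x ^ 3 / 6| := abs_sub _ _
    _ ≤ |x| ^ 3 := by rw [h3]; linarith

/-- The integrand of `tiltedIntegral` after rescaling by `√τ`. -/
def scaledIntegrand (τ θ a y : ℝ) : ℝ :=
  Set.indicator (Set.Ioc (-(√τ * Real.pi)) (√τ * Real.pi))
    (fun y => Real.exp (τ * Real.cosh θ * (Real.cos (y / √τ) - 1)) *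
      Real.cos (τ * Real.sinh θ * Real.sin (y / √τ) - a * (y / √τ))) y

lemma sqrt_mul_tiltedIntegral {τ : ℝ} (hτ : 0 < τ) (θ a : ℝ) :
    √τ * tiltedIntegral τ θ a = ∫ y, scaledIntegrand τ θ a y := by
  have hs : 0 < √τ := Real.sqrt_pos.2 hτ
  have hπ := Real.pi_pos
  unfold scaledIntegrand
  rw [integral_indicator measurableSet_Ioc, ← intervalIntegral.integral_of_le (by nlinarith),
    intervalIntegral.integral_comp_div (fun s => Real.exp (τ * Real.cosh θ * (Real.cos s - 1)) *
      Real.cos (τ * Real.sinh θ * Real.sin s - a * s)) hs.ne', smul_eq_mul, tiltedIntegral]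
  congr 2 <;> field_simp

/-- Uses cos s ≤ 1 - (2/π²)s² on [-π, π] and cosh θ ≥ 1. The bound is uniform in τ, θ and a, so it
serves both in the local limit theorem and in the domination of the final double sum. -/
lemma norm_scaledIntegrand_le {τ : ℝ} (hτ : 0 < τ) (θ a y : ℝ) :
    ‖scaledIntegrand τ θ a y‖ ≤ Real.exp (-(2 / Real.pi ^ 2) * y ^ 2) := by
  have hs : 0 < √τ := Real.sqrt_pos.2 hτ
  have hπ := Real.pi_pos
  unfold scaledIntegrand
  by_cases hy : y ∈ Set.Ioc (-(√τ * Real.pi)) (√τ * Real.pi)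
  · rw [Set.indicator_of_mem hy, norm_mul, Real.norm_of_nonneg (Real.exp_pos _).le]
    refine (mul_le_of_le_one_right (Real.exp_pos _).le (Real.abs_cos_le_one _)).trans ?_
    rw [Real.exp_le_exp]
    have habs : |y / √τ| ≤ Real.pi := by
      rw [abs_div, abs_of_pos hs, div_le_iff₀ hs, abs_le]
      constructor <;> nlinarith [hy.1, hy.2]
    have h1 := Real.cos_le_one_sub_mul_cos_sq habs
    have h2 := Real.one_le_cosh θ
    have h3 : Real.cos (y / √τ) - 1 ≤ -(2 / Real.pi ^ 2 * (y / √τ) ^ 2) := by linarith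
    have h4 : (y / √τ) ^ 2 = y ^ 2 / τ := by rw [div_pow, Real.sq_sqrt hτ.le]
    have h5 : Real.cos (y / √τ) - 1 ≤ 0 := by linarith [Real.cos_le_one (y / √τ)]
    calc τ * Real.cosh θ * (Real.cos (y / √τ) - 1) ≤ τ * (Real.cos (y / √τ) - 1) := by
          have : τ ≤ τ * Real.cosh θ := le_mul_of_one_le_right hτ.le h2
          exact mul_le_mul_of_nonpos_right this h5
      _ ≤ τ * -(2 / Real.pi ^ 2 * (y / √τ) ^ 2) := by gcongr
      _ = _ := by rw [h4]; field_simp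
  · rw [Set.indicator_of_notMem hy, norm_zero]
    positivity

lemma integrable_gaussian_bound : Integrable fun y : ℝ => Real.exp (-(2 / Real.pi ^ 2) * y ^ 2) :=
  integrable_exp_neg_mul_sq (by have := Real.pi_pos; positivity)

lemma abs_sqrt_mul_tiltedIntegral_le {τ : ℝ} (hτ : 0 < τ) (θ a : ℝ) :
    |√τ * tiltedIntegral τ θ a| ≤ ∫ y : ℝ, Real.exp (-(2 / Real.pi ^ 2) * y ^ 2) := by
  rw [sqrt_mul_tiltedIntegral hτ, ← Real.norm_eq_abs]
  exact norm_integral_le_of_norm_le integrable_gaussian_bound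
    (Eventually.of_forall fun y => norm_scaledIntegrand_le hτ θ a y)

lemma measurable_scaledIntegrand (τ θ a : ℝ) : Measurable (scaledIntegrand τ θ a) := by
  unfold scaledIntegrand
  refine Measurable.indicator ?_ measurableSet_Ioc
  fun_prop

/-- The exponent tends to -y²/2 and the phase to 0. Hypothesis `ha` puts a within o(√τ) of the
approximate tilted mean τθ; `hθ3` makes the error of replacing sinh θ by θ in that mean negligible.
-/
lemma tendsto_scaledIntegrand {ι : Type*} {l : Filter ι} {τ θ a : ι → ℝ}
    (hτ : Tendsto τ l atTop) (hθ : Tendsto θ l (𝓝 0))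
    (hθ3 : Tendsto (fun i => √(τ i) * |θ i| ^ 3) l (𝓝 0))
    (ha : Tendsto (fun i => (a i - τ i * θ i) / √(τ i)) l (𝓝 0)) (y : ℝ) :
    Tendsto (fun i => scaledIntegrand (τ i) (θ i) (a i) y) l (𝓝 (Real.exp (-(1 / 2) * y ^ 2))) := by
  have hs : Tendsto (fun i => √(τ i)) l atTop := Real.tendsto_sqrt_atTop.comp hτ
  have hinv : Tendsto (fun i => (√(τ i))⁻¹) l (𝓝 0) := tendsto_inv_atTop_zero.comp hs
  have hh : Tendsto (fun i => y / √(τ i)) l (𝓝 0) := by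
    simpa [div_eq_mul_inv] using hinv.const_mul y
  have hτ0 : ∀ᶠ i in l, 0 < τ i := hτ.eventually_gt_atTop 0
  have hh1 : ∀ᶠ i in l, |y / √(τ i)| ≤ 1 := by
    have : Tendsto (fun i => |y / √(τ i)|) l (𝓝 0) := by simpa using hh.abs
    exact (this.eventually (gt_mem_nhds one_pos)).mono fun i h => le_of_lt h
  have hθ1 : ∀ᶠ i in l, |θ i| ≤ 1 := by
    have : Tendsto (fun i => |θ i|) l (𝓝 0) := by simpa using hθ.abs
    exact (this.eventually (gt_mem_nhds one_pos)).mono fun i h => le_of_lt h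
  have hcos : Tendsto (fun i => τ i * (Real.cos (y / √(τ i)) - 1)) l (𝓝 (-(1 / 2) * y ^ 2)) := by
    rw [tendsto_iff_norm_sub_tendsto_zero]
    have hb : Tendsto (fun i => |y| ^ 2 * |y / √(τ i)| ^ 2) l (𝓝 0) := by
      simpa using (hh.pow 2).const_mul (y ^ 2)
    refine squeeze_zero' (Eventually.of_forall fun _ => norm_nonneg _) ?_ hb
    filter_upwards [hτ0, hh1] with i h0 h1
    have h2 := Real.cos_bound h1
    have hsq : τ i * (y / √(τ i)) ^ 2 = y ^ 2 := by
      rw [div_pow, Real.sq_sqrt h0.le]; field_simp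
    have hsq2 : τ i * |y / √(τ i)| ^ 2 = |y| ^ 2 := by rw [sq_abs, sq_abs, hsq]
    have e1 : τ i * (Real.cos (y / √(τ i)) - 1) - -(1 / 2) * y ^ 2 =
        τ i * (Real.cos (y / √(τ i)) - (1 - (y / √(τ i)) ^ 2 / 2)) := by
      rw [← hsq]; ring
    rw [e1, Real.norm_eq_abs, abs_mul, abs_of_pos h0]
    calc _ ≤ τ i * (|y / √(τ i)| ^ 4 * (5 / 96)) := by gcongr
      _ ≤ τ i * (|y / √(τ i)| ^ 4 * 1) := by gcongr; norm_num
      _ = (τ i * |y / √(τ i)| ^ 2) * |y / √(τ i)| ^ 2 := by ring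
      _ = _ := by rw [hsq2]
  have hcosh : Tendsto (fun i => Real.cosh (θ i)) l (𝓝 1) := by
    have := (Real.continuous_cosh.tendsto 0).comp hθ
    rwa [Real.cosh_zero] at this
  have hexp : Tendsto (fun i => Real.exp (τ i * Real.cosh (θ i) * (Real.cos (y / √(τ i)) - 1))) l
      (𝓝 (Real.exp (-(1 / 2) * y ^ 2))) := by
    have := (Real.continuous_exp.tendsto _).comp (hcos.mul hcosh)
    rw [mul_one] at this
    refine this.congr fun i => ?_
    simp only [Function.comp]
    ring_nf
  have hphase : Tendsto (fun i => τ i * Real.sinh (θ i) * Real.sin (y / √(τ i)) -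
      a i * (y / √(τ i))) l (𝓝 0) := by
    -- The phase splits into three errors: linearising sinh (`p1`), linearising sin (`p2`), and the
    -- mismatch between a and τθ (`p3`).
    have p1 : Tendsto (fun i => τ i * (Real.sinh (θ i) - θ i) * Real.sin (y / √(τ i))) l (𝓝 0) := by
      have hb : Tendsto (fun i => √(τ i) * |θ i| ^ 3 * |y|) l (𝓝 0) := by
        simpa using hθ3.mul_const |y|
      refine squeeze_zero_norm' ?_ hb
      filter_upwards [hτ0, hθ1] with i h0 h1
      have hsp : 0 < √(τ i) := Real.sqrt_pos.2 h0
      rw [Real.norm_eq_abs, abs_mul, abs_mul, abs_of_pos h0]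
      calc _ ≤ τ i * |θ i| ^ 3 * |y / √(τ i)| := by
            have h2 := abs_sinh_sub_self_le h1
            have h3 : |Real.sin (y / √(τ i))| ≤ |y / √(τ i)| := Real.abs_sin_le_abs
            exact mul_le_mul (mul_le_mul_of_nonneg_left h2 h0.le) h3 (abs_nonneg _)
              (by positivity)
        _ = _ := by
            rw [abs_div, abs_of_pos hsp]
            nth_rewrite 1 [← Real.mul_self_sqrt h0.le]
            field_simp
    have p2 : Tendsto (fun i => τ i * θ i * (Real.sin (y / √(τ i)) - y / √(τ i))) l (𝓝 0) := by
      have hb : Tendsto (fun i => |θ i| * |y| ^ 2 * |y / √(τ i)|) l (𝓝 0) := by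
        simpa using (hθ.abs.mul_const (y ^ 2)).mul hh.abs
      refine squeeze_zero_norm' ?_ hb
      filter_upwards [hτ0, hh1] with i h0 h1
      have hsq2 : τ i * |y / √(τ i)| ^ 2 = |y| ^ 2 := by
        rw [sq_abs, sq_abs, div_pow, Real.sq_sqrt h0.le]; field_simp
      rw [Real.norm_eq_abs, abs_mul, abs_mul, abs_of_pos h0]
      calc _ ≤ τ i * |θ i| * |y / √(τ i)| ^ 3 := by gcongr; exact abs_sin_sub_self_le h1
        _ = |θ i| * (τ i * |y / √(τ i)| ^ 2) * |y / √(τ i)| := by ring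
        _ = _ := by rw [hsq2]
    have p3 : Tendsto (fun i => (a i - τ i * θ i) / √(τ i) * y) l (𝓝 0) := by
      simpa using ha.mul_const y
    have := (p1.add p2).sub p3
    rw [add_zero, sub_zero] at this
    refine this.congr fun i => ?_
    ring
  have hmem : ∀ᶠ i in l, y ∈ Set.Ioc (-(√(τ i) * Real.pi)) (√(τ i) * Real.pi) := by
    filter_upwards [(hs.atTop_mul_const Real.pi_pos).eventually_gt_atTop |y|] with i hi
    rw [abs_lt] at hi
    exact ⟨hi.1, hi.2.le⟩
  have hfin := hexp.mul ((Real.continuous_cos.tendsto _).comp hphase)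
  rw [Real.cos_zero, mul_one] at hfin
  refine hfin.congr' ?_
  filter_upwards [hmem] with i hi
  rw [scaledIntegrand, Set.indicator_of_mem hi]
  rfl

/-- A local central limit theorem for tilted walks. -/
lemma tendsto_sqrt_mul_tiltedIntegral {ι : Type*} {l : Filter ι} [l.IsCountablyGenerated]
    {τ θ a : ι → ℝ}
    (hτ : Tendsto τ l atTop) (hθ : Tendsto θ l (𝓝 0))
    (hθ3 : Tendsto (fun i => √(τ i) * |θ i| ^ 3) l (𝓝 0))
    (ha : Tendsto (fun i => (a i - τ i * θ i) / √(τ i)) l (𝓝 0)) :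
    Tendsto (fun i => √(τ i) * tiltedIntegral (τ i) (θ i) (a i)) l (𝓝 √(2 * Real.pi)) := by
  have hτ0 : ∀ᶠ i in l, 0 < τ i := hτ.eventually_gt_atTop 0
  have h := tendsto_integral_filter_of_dominated_convergence (μ := volume) (l := l)
    (F := fun i y => scaledIntegrand (τ i) (θ i) (a i) y)
    (fun y => Real.exp (-(2 / Real.pi ^ 2) * y ^ 2))
    (Eventually.of_forall fun i => (measurable_scaledIntegrand _ _ _).aestronglyMeasurable)
    (hτ0.mono fun i hi => Eventually.of_forall fun y => norm_scaledIntegrand_le hi _ _ y)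
    integrable_gaussian_bound
    (Eventually.of_forall fun y => tendsto_scaledIntegrand hτ hθ hθ3 ha y)
  rw [integral_gaussian, show Real.pi / (1 / 2) = 2 * Real.pi by ring] at h
  exact h.congr' (hτ0.mono fun i hi => (sqrt_mul_tiltedIntegral hi _ _).symm)

/-! ### Asymptotics of the scales, the level and the tilt. -/

lemma tendsto_sub_mul_log_div_atTop (p q : ℝ) :
    Tendsto (fun u : ℝ => (p - q * Real.log u) / u) atTop (𝓝 0) := by
  have h0 := Real.tendsto_pow_log_div_mul_add_atTop 1 0 0 one_ne_zero
  have h1 := Real.tendsto_pow_log_div_mul_add_atTop 1 0 1 one_ne_zero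
  have := (h0.const_mul p).sub (h1.const_mul q)
  simp only [mul_zero, sub_zero, one_mul, add_zero, pow_zero, pow_one] at this
  refine this.congr fun u => ?_
  ring

lemma tendsto_sub_mul_log_sq_div_atTop (p q : ℝ) :
    Tendsto (fun u : ℝ => (p - q * Real.log u) ^ 2 / u) atTop (𝓝 0) := by
  have h0 := Real.tendsto_pow_log_div_mul_add_atTop 1 0 0 one_ne_zero
  have h1 := Real.tendsto_pow_log_div_mul_add_atTop 1 0 1 one_ne_zero
  have h2 := Real.tendsto_pow_log_div_mul_add_atTop 1 0 2 one_ne_zero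
  have := ((h0.const_mul (p ^ 2)).sub (h1.const_mul (2 * p * q))).add (h2.const_mul (q ^ 2))
  simp only [mul_zero, sub_zero, one_mul, add_zero, pow_zero, pow_one] at this
  refine this.congr fun u => ?_
  ring

lemma aScale_eq (β : ℝ) {t : ℝ} (ht : 1 < t) :
    aScale β t = Real.log t - Real.log (2 * Real.pi) / (2 * β) -
      (β + 1) / (2 * β) * Real.log (Real.log t) := by
  have hL : 0 < Real.log t := Real.log_pos ht
  have hπ := Real.pi_pos
  rw [aScale, Real.log_div (by positivity) (by positivity),
    Real.log_mul (by positivity) (by positivity), Real.log_rpow (by positivity),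
    Real.log_rpow hL]
  ring

/-- The exponential tilt that centres the first coordinate of the walk at the level. -/
def tilt (d : ℕ) (β x t : ℝ) : ℝ := level d β x t / (t / d)

lemma tendsto_add_aScale_div_log (β x : ℝ) :
    Tendsto (fun t => (x + aScale β t) / Real.log t) atTop (𝓝 1) := by
  have h := ((tendsto_sub_mul_log_div_atTop (x - Real.log (2 * Real.pi) / (2 * β))
    ((β + 1) / (2 * β))).comp Real.tendsto_log_atTop).const_add 1
  rw [add_zero] at h
  refine h.congr' ?_
  filter_upwards [eventually_gt_atTop 1] with t ht
  have hL : 0 < Real.log t := Real.log_pos ht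
  rw [aScale_eq β ht, Function.comp]
  field_simp
  ring

section Scales

variable {d : ℕ} {β : ℝ}

lemma bScale_sq (hβ : 0 < β) {t : ℝ} (ht : 1 < t) :
    bScale d β t ^ 2 = β * t / (d * Real.log t) := by
  have hL : 0 < Real.log t := Real.log_pos ht
  rw [bScale, Real.sq_sqrt (by positivity)]

lemma bScale_pos (hd : 0 < d) (hβ : 0 < β) {t : ℝ} (ht : 1 < t) : 0 < bScale d β t := by
  have hL : 0 < Real.log t := Real.log_pos ht
  have hd' : (0 : ℝ) < d := by exact_mod_cast hd
  exact Real.sqrt_pos.2 (by positivity)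

lemma tendsto_bScale (hd : 0 < d) (hβ : 0 < β) : Tendsto (bScale d β) atTop atTop := by
  have hd' : (0 : ℝ) < d := by exact_mod_cast hd
  refine Real.tendsto_sqrt_atTop.comp ?_
  have h1 := Real.tendsto_pow_log_div_mul_add_atTop 1 0 1 one_ne_zero
  simp only [one_mul, add_zero, pow_one] at h1
  have h2 : Tendsto (fun t : ℝ => (Real.log t / t)⁻¹) atTop atTop := by
    refine tendsto_inv_nhdsGT_zero.comp (tendsto_nhdsWithin_iff.2 ⟨h1, ?_⟩)
    filter_upwards [eventually_gt_atTop 1] with t ht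
    exact div_pos (Real.log_pos ht) (by linarith)
  refine (h2.const_mul_atTop (by positivity : 0 < β / d)).congr fun t => ?_
  rw [inv_div]
  ring

lemma tilt_mul_bScale (hd : 0 < d) (hβ : 0 < β) (x : ℝ) {t : ℝ} (ht : 1 < t) :
    tilt d β x t * bScale d β t = β * ((x + aScale β t) / Real.log t) := by
  have hL : 0 < Real.log t := Real.log_pos ht
  have hd' : (0 : ℝ) < d := by exact_mod_cast hd
  have : tilt d β x t * bScale d β t = bScale d β t ^ 2 * (x + aScale β t) / (t / d) := by
    rw [tilt, level]; ring
  rw [this, bScale_sq hβ ht]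
  field_simp

/-- This identifies b_t as the natural window: a move of b_t v beyond the level costs a factor
e^{-βv} in the limit. -/
lemma tendsto_tilt_mul_bScale (hd : 0 < d) (hβ : 0 < β) (x : ℝ) :
    Tendsto (fun t => tilt d β x t * bScale d β t) atTop (𝓝 β) := by
  have := (tendsto_add_aScale_div_log β x).const_mul β
  rw [mul_one] at this
  refine this.congr' ?_
  filter_upwards [eventually_gt_atTop 1] with t ht
  exact (tilt_mul_bScale hd hβ x ht).symm

lemma tendsto_tilt (hd : 0 < d) (hβ : 0 < β) (x : ℝ) :
    Tendsto (tilt d β x) atTop (𝓝 0) := by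
  have := (tendsto_tilt_mul_bScale hd hβ x).mul (tendsto_inv_atTop_zero.comp (tendsto_bScale hd hβ))
  rw [mul_zero] at this
  refine this.congr' ?_
  filter_upwards [eventually_gt_atTop 1] with t ht
  have := bScale_pos hd hβ ht
  simp only [Function.comp]
  field_simp

/-- The window is small against the diffusive scale, so all lattice points within O(b_t) of the
level share one tilt in the local limit theorem. -/
lemma tendsto_bScale_div_sqrt (hd : 0 < d) (hβ : 0 < β) :
    Tendsto (fun t => bScale d β t / √(t / d)) atTop (𝓝 0) := by
  have hd' : (0 : ℝ) < d := by exact_mod_cast hd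
  have h1 : Tendsto (fun t => √(β * (Real.log t)⁻¹)) atTop (𝓝 0) := by
    have h2 := (tendsto_inv_atTop_zero.comp Real.tendsto_log_atTop).const_mul β
    rw [mul_zero] at h2
    simpa using h2.sqrt
  refine h1.congr' ?_
  filter_upwards [eventually_gt_atTop 1] with t ht
  have hL : 0 < Real.log t := Real.log_pos ht
  rw [bScale, ← Real.sqrt_div (by positivity)]
  congr 1
  field_simp

lemma tendsto_mul_tilt_pow_four (hd : 0 < d) (hβ : 0 < β) (x : ℝ) :
    Tendsto (fun t => t / d * tilt d β x t ^ 4) atTop (𝓝 0) := by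
  have hd' : (0 : ℝ) < d := by exact_mod_cast hd
  have h1 := Real.tendsto_pow_log_div_mul_add_atTop 1 0 2 one_ne_zero
  simp only [one_mul, add_zero] at h1
  -- As θ is of order 1/b_t, the quantity tθ⁴ is of order (log t)²/t.
  have h2 := (((tendsto_tilt_mul_bScale hd hβ x).pow 4).mul h1).const_mul (d / β ^ 2)
  rw [mul_zero, mul_zero] at h2
  refine h2.congr' ?_
  filter_upwards [eventually_gt_atTop 1] with t ht
  have hL : 0 < Real.log t := Real.log_pos ht
  have hb : bScale d β t ^ 4 = (β * t / (d * Real.log t)) ^ 2 := by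
    rw [← bScale_sq hβ ht]; ring
  rw [mul_pow, hb]
  field_simp

lemma tendsto_sqrt_mul_tilt_pow_three (hd : 0 < d) (hβ : 0 < β) (x : ℝ) :
    Tendsto (fun t => √(t / d) * |tilt d β x t| ^ 3) atTop (𝓝 0) := by
  have h := ((tendsto_mul_tilt_pow_four hd hβ x).mul ((tendsto_tilt hd hβ x).pow 2)).sqrt
  simp only [ne_eq, OfNat.ofNat_ne_zero, not_false_eq_true, zero_pow, mul_zero,
    Real.sqrt_zero] at h
  refine h.congr' ?_
  filter_upwards [eventually_gt_atTop 1] with t ht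
  have h1 : t / d * tilt d β x t ^ 4 * tilt d β x t ^ 2 = t / d * (|tilt d β x t| ^ 3) ^ 2 := by
    have : (|tilt d β x t| ^ 3) ^ 2 = (|tilt d β x t| ^ 2) ^ 3 := by ring
    rw [this, sq_abs]; ring
  rw [h1, Real.sqrt_mul' _ (by positivity), Real.sqrt_sq (by positivity)]

lemma level_eq_mul_tilt (hd : 0 < d) (x : ℝ) {t : ℝ} (ht : 1 < t) :
    level d β x t = t / d * tilt d β x t := by
  have hd' : (0 : ℝ) < d := by exact_mod_cast hd
  rw [tilt]
  field_simp

/-- The weight of the exponential tilt, normalised by the window size. -/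
def tiltWeight (d : ℕ) (β x t : ℝ) : ℝ :=
  bScale d β t ^ (β + 1) / √(t / d) *
    Real.exp (t / d * (Real.cosh (tilt d β x t) - 1) - tilt d β x t * level d β x t)

/-- Take logarithms, with L = log t. Up to o(1) the exponential contributes -(β/2)(x + a_t)²/L,
whose expansion has terms in L, log L and constants. The terms in L and log L cancel those of
b_t^{β+1}/√(t/d); this dictates the shape of a_t. In the power β + 1, a factor b_t² comes from the
double sum and b_t^{β-1} from the cross section. -/
lemma tendsto_tiltWeight (hd : 0 < d) (hβ : 0 < β) (x : ℝ) :
    Tendsto (tiltWeight d β x) atTop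
      (𝓝 (β ^ ((β + 1) / 2) * (d : ℝ) ^ (-(β / 2)) * Real.exp (-(β * x)) * √(2 * Real.pi))) := by
  have hd' : (0 : ℝ) < d := by exact_mod_cast hd
  have hπ := Real.pi_pos
  set κ := Real.log (2 * Real.pi) / (2 * β) with hκ
  set γ := (β + 1) / (2 * β) with hγ
  have hE1 : Tendsto (fun t => t / d * (Real.cosh (tilt d β x t) - 1 - tilt d β x t ^ 2 / 2))
      atTop (𝓝 0) := by
    refine squeeze_zero_norm' ?_ (tendsto_mul_tilt_pow_four hd hβ x)
    have hθ : Tendsto (fun t => |tilt d β x t|) atTop (𝓝 0) := by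
      simpa using (tendsto_tilt hd hβ x).abs
    filter_upwards [eventually_gt_atTop 1, hθ.eventually (gt_mem_nhds one_pos)] with t ht h1
    have h2 : |tilt d β x t| ^ 4 = tilt d β x t ^ 4 := by
      rw [← abs_pow, abs_of_nonneg (by positivity)]
    have h3 : 0 < t / d := by positivity
    rw [Real.norm_eq_abs, abs_mul, abs_of_pos h3, ← h2]
    exact mul_le_mul_of_nonneg_left (abs_cosh_sub_le h1.le) h3.le
  have hE2 : Tendsto (fun t => β / 2 * ((x - κ - γ * Real.log (Real.log t)) ^ 2 / Real.log t))
      atTop (𝓝 0) := by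
    have := ((tendsto_sub_mul_log_sq_div_atTop (x - κ) γ).comp
      Real.tendsto_log_atTop).const_mul (β / 2)
    rwa [mul_zero] at this
  have hE := Real.continuous_exp.continuousAt.tendsto.comp ((hE1.sub hE2).const_add
    ((β + 1) / 2 * Real.log β - β / 2 * Real.log d - β * x + 1 / 2 * Real.log (2 * Real.pi)))
  rw [sub_zero, add_zero] at hE
  have hlim : Real.exp ((β + 1) / 2 * Real.log β - β / 2 * Real.log d - β * x +
      1 / 2 * Real.log (2 * Real.pi)) =
      β ^ ((β + 1) / 2) * (d : ℝ) ^ (-(β / 2)) * Real.exp (-(β * x)) * √(2 * Real.pi) := by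
    rw [Real.rpow_def_of_pos hβ, Real.rpow_def_of_pos hd', Real.sqrt_eq_rpow,
      Real.rpow_def_of_pos (by positivity), ← Real.exp_add, ← Real.exp_add, ← Real.exp_add]
    congr 1
    ring
  rw [hlim] at hE
  refine hE.congr' ?_
  filter_upwards [eventually_gt_atTop 1] with t ht
  have hL : 0 < Real.log t := Real.log_pos ht
  have ht0 : 0 < t := by linarith
  have hb := bScale_pos hd hβ ht
  have hlogb : Real.log (bScale d β t) =
      1 / 2 * (Real.log β + Real.log t - Real.log d - Real.log (Real.log t)) := by
    rw [bScale, Real.log_sqrt (by positivity), Real.log_div (by positivity) (by positivity),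
      Real.log_mul (by positivity) (by positivity), Real.log_mul (by positivity) (by positivity)]
    ring
  have hz : tilt d β x t * level d β x t = t / d * tilt d β x t ^ 2 := by
    rw [level_eq_mul_tilt hd x ht]; ring
  have hsq : t / d * tilt d β x t ^ 2 = β * ((x + aScale β t) ^ 2 / Real.log t) := by
    have h1 : t / d * tilt d β x t ^ 2 =
        bScale d β t ^ 2 * (x + aScale β t) ^ 2 * (t / d)⁻¹ := by
      rw [tilt, level]; field_simp
    rw [h1, bScale_sq hβ ht]
    field_simp
  have hroot : √(t / d) = Real.exp (1 / 2 * (Real.log t - Real.log d)) := by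
    rw [Real.sqrt_eq_rpow, Real.rpow_def_of_pos (by positivity),
      Real.log_div (by positivity) (by positivity)]
    congr 1; ring
  rw [Function.comp, tiltWeight, Real.rpow_def_of_pos hb, hroot, ← Real.exp_sub, ← Real.exp_add,
    hlogb]
  congr 1
  have h3 : t / d * (Real.cosh (tilt d β x t) - 1) - tilt d β x t * level d β x t =
      t / d * (Real.cosh (tilt d β x t) - 1 - tilt d β x t ^ 2 / 2) -
        β * ((x + aScale β t) ^ 2 / Real.log t) / 2 := by
    rw [← hsq, hz]; ring
  rw [h3, aScale_eq β ht, ← hκ, ← hγ]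
  -- The constants of a_t at work: βκ produces the factor √(2π), and βγ = (β+1)/2 cancels the log
  -- log t term of b_t^{β+1}.
  have hκ' : β * κ = Real.log (2 * Real.pi) / 2 := by rw [hκ]; field_simp
  have hγ' : β * γ = (β + 1) / 2 := by rw [hγ]; field_simp
  have hexp : β * ((x + (Real.log t - κ - γ * Real.log (Real.log t))) ^ 2 / Real.log t) / 2 =
      β / 2 * ((x - κ - γ * Real.log (Real.log t)) ^ 2 / Real.log t) + β / 2 * Real.log t +
        (β * x - β * κ - β * γ * Real.log (Real.log t)) := by
    field_simp
    ring
  rw [hexp, hκ', hγ']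
  ring

end Scales

/-! ### Cross sections of the polynomial shapes on the scale b. -/

lemma tendsto_floor_mul_div {ι : Type*} {l : Filter ι} {b : ι → ℝ} (hb : Tendsto b l atTop)
    {w : ℝ} (hw : 0 ≤ w) : Tendsto (fun i => (⌊b i * w⌋₊ : ℝ) / b i) l (𝓝 w) := by
  simpa only [mul_comm, Function.comp_def] using (tendsto_nat_floor_mul_div_atTop hw).comp hb

lemma crossSection_nonneg {n : ℕ} {g : Fin n → ℝ → ℝ} {u : ℝ} (hg : ∀ i, 0 ≤ g i u) :
    0 ≤ crossSection g u := by
  refine Finset.prod_nonneg fun i _ => ?_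
  have : (0 : ℝ) ≤ ⌊g i u⌋ := by exact_mod_cast Int.floor_nonneg.2 (hg i)
  linarith

section PolyShape

variable {n : ℕ} {c α r : Fin n → ℝ}

lemma polyShape_nonneg (hc : ∀ i, 0 < c i) (hr : ∀ i, 0 ≤ r i) (i : Fin n) {u : ℝ} (hu : 0 ≤ u) :
    0 ≤ polyShape c α r i u :=
  add_nonneg (mul_nonneg (hc i).le (Real.rpow_nonneg hu _)) (hr i)

lemma rpow_beta_sub_one {b : ℝ} (hb : 0 < b) : b ^ (beta α - 1) = ∏ i, b ^ α i := by
  rw [beta, add_sub_cancel_left, Real.rpow_sum_of_pos hb]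

/-- Factor by factor, b^{β-1} being the product of the b^{α_i}. Since b ≥ 1, also 1 ≤
((1+w)b)^{α_i}, which absorbs r_i and the additive 1. -/
lemma crossSection_polyShape_div_le (hc : ∀ i, 0 < c i) (hα : ∀ i, 0 ≤ α i) (hr : ∀ i, 0 ≤ r i)
    {b w : ℝ} (hb : 1 ≤ b) (hw : 0 ≤ w) :
    crossSection (polyShape c α r) (⌊b * w⌋₊ : ℝ) / b ^ (beta α - 1) ≤
      (∏ i, (2 * c i + 2 * r i + 1)) * (1 + w) ^ (beta α - 1) := by
  have hb0 : 0 < b := by linarith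
  rw [rpow_beta_sub_one hb0, rpow_beta_sub_one (by linarith), crossSection,
    ← Finset.prod_div_distrib, ← Finset.prod_mul_distrib]
  have hu : (0 : ℝ) ≤ (⌊b * w⌋₊ : ℝ) := by positivity
  have hf : (⌊b * w⌋₊ : ℝ) ≤ b * w := Nat.floor_le (by positivity)
  refine Finset.prod_le_prod (fun i _ => ?_) fun i _ => ?_
  · have : (0 : ℝ) ≤ ⌊polyShape c α r i (⌊b * w⌋₊ : ℝ)⌋ := by
      exact_mod_cast Int.floor_nonneg.2 (polyShape_nonneg hc hr i hu)
    positivity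
  · have h1 := Int.floor_le (polyShape c α r i (⌊b * w⌋₊ : ℝ))
    have h2 : (⌊b * w⌋₊ : ℝ) ^ α i ≤ (1 + w) ^ α i * b ^ α i := by
      rw [← Real.mul_rpow (by linarith) hb0.le]
      exact Real.rpow_le_rpow hu (by nlinarith) (hα i)
    have h3 : 1 ≤ (1 + w) ^ α i * b ^ α i := by
      rw [← Real.mul_rpow (by linarith) hb0.le]
      exact Real.one_le_rpow (by nlinarith) (hα i)
    rw [div_le_iff₀ (by positivity)]
    unfold polyShape at h1 ⊢
    have h4 := mul_le_mul_of_nonneg_left h2 (hc i).le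
    have h5 := mul_le_mul_of_nonneg_left h3 (hr i)
    nlinarith

open Classical in
/-- The leading coefficient of the cross section for the shapes `polyShape c α r`. -/
def leadingCoeff (c α r : Fin n → ℝ) : ℝ :=
  (∏ i with α i = 0, (2 * (⌊c i + r i⌋ : ℝ) + 1)) * ∏ i with 0 < α i, 2 * c i

open Classical in
lemma leadingCoeff_mul_rpow (hα : ∀ i, 0 ≤ α i) {w : ℝ} (hw : 0 < w) :
    leadingCoeff c α r * w ^ (beta α - 1) =
      ∏ i, if α i = 0 then 2 * (⌊c i + r i⌋ : ℝ) + 1 else 2 * c i * w ^ α i := by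
  have h1 : ∏ i with 0 < α i, 2 * c i = ∏ i with ¬ α i = 0, 2 * c i := by
    refine Finset.prod_congr (Finset.filter_congr fun i _ => ?_) fun _ _ => rfl
    exact ⟨fun h => h.ne', fun h => lt_of_le_of_ne (hα i) (Ne.symm h)⟩
  rw [leadingCoeff, h1, ← Finset.prod_ite, rpow_beta_sub_one hw, ← Finset.prod_mul_distrib]
  refine Finset.prod_congr rfl fun i _ => ?_
  split_ifs with h
  · rw [h, Real.rpow_zero, mul_one]
  · rfl

/-- Factors with α_i = 0 are constant and keep their floor; in the others, the floor, r_i and the 1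
vanish after division by b^{α_i}. -/
lemma tendsto_crossSection_polyShape_div (hα : ∀ i, 0 ≤ α i) {ι : Type*} {l : Filter ι}
    {b : ι → ℝ} (hb : Tendsto b l atTop) {w : ℝ} (hw : 0 < w) :
    Tendsto (fun j => crossSection (polyShape c α r) (⌊b j * w⌋₊ : ℝ) / b j ^ (beta α - 1)) l
      (𝓝 (leadingCoeff c α r * w ^ (beta α - 1))) := by
  rw [leadingCoeff_mul_rpow hα hw]
  have hb0 : ∀ᶠ j in l, 0 < b j := hb.eventually_gt_atTop 0
  have hprod : Tendsto (fun j => ∏ i, (2 * (⌊polyShape c α r i (⌊b j * w⌋₊ : ℝ)⌋ : ℝ) + 1) /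
      b j ^ α i) l
      (𝓝 (∏ i, if α i = 0 then 2 * (⌊c i + r i⌋ : ℝ) + 1 else 2 * c i * w ^ α i)) := by
    refine tendsto_finsetProd _ fun i _ => ?_
    split_ifs with h
    · simp only [polyShape, h, Real.rpow_zero, mul_one, div_one]
      exact tendsto_const_nhds
    · have hpos : 0 < α i := lt_of_le_of_ne (hα i) (Ne.symm h)
      have hbα : Tendsto (fun j => (b j ^ α i)⁻¹) l (𝓝 0) :=
        tendsto_inv_atTop_zero.comp ((tendsto_rpow_atTop hpos).comp hb)
      have hmain : Tendsto (fun j => 2 * c i * ((⌊b j * w⌋₊ : ℝ) / b j) ^ α i) l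
          (𝓝 (2 * c i * w ^ α i)) :=
        ((tendsto_floor_mul_div hb hw.le).rpow_const (Or.inr hpos.le)).const_mul _
      have herr : Tendsto (fun j => (2 * (⌊polyShape c α r i (⌊b j * w⌋₊ : ℝ)⌋ : ℝ) + 1 -
          2 * (c i * (⌊b j * w⌋₊ : ℝ) ^ α i)) * (b j ^ α i)⁻¹) l (𝓝 0) := by
        have hC := hbα.const_mul (2 * |r i| + 3)
        rw [mul_zero] at hC
        refine squeeze_zero_norm' ?_ hC
        filter_upwards [hb0] with j hj
        rw [norm_mul, Real.norm_of_nonneg (by positivity : (0 : ℝ) ≤ (b j ^ α i)⁻¹)]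
        gcongr
        have h1 := Int.floor_le (polyShape c α r i (⌊b j * w⌋₊ : ℝ))
        have h2 := Int.lt_floor_add_one (polyShape c α r i (⌊b j * w⌋₊ : ℝ))
        rw [Real.norm_eq_abs, abs_le]
        unfold polyShape at h1 h2 ⊢
        have := neg_abs_le (r i)
        have := le_abs_self (r i)
        constructor <;> linarith
      have := hmain.add herr
      rw [add_zero] at this
      refine this.congr' ?_
      filter_upwards [hb0] with j hj
      rw [Real.div_rpow (by positivity) hj.le]
      ring
  refine hprod.congr' ?_
  filter_upwards [hb0] with j hj
  rw [rpow_beta_sub_one hj, crossSection, Finset.prod_div_distrib]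

end PolyShape

/-! ### From lattice sums to integrals. -/

lemma tsum_nat_eq_lintegral_floor {b : ℝ} (hb : 0 < b) (f : ℕ → ℝ≥0∞) :
    ∑' j, f j = ∫⁻ v in Set.Ioi (0 : ℝ), ENNReal.ofReal b * f ⌊b * v⌋₊ := by
  have hU : Set.Ici (0 : ℝ) = ⋃ j : ℕ, Set.Ico ((j : ℝ) / b) ((j + 1 : ℝ) / b) := by
    ext v
    simp only [Set.mem_Ici, Set.mem_iUnion, Set.mem_Ico]
    constructor
    · intro hv
      refine ⟨⌊b * v⌋₊, ?_, ?_⟩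
      · rw [div_le_iff₀' hb]; exact Nat.floor_le (by positivity)
      · rw [lt_div_iff₀' hb]; exact Nat.lt_floor_add_one _
    · rintro ⟨j, hj, -⟩
      exact le_trans (by positivity) hj
  have hfl : ∀ (j : ℕ) (v : ℝ), v ∈ Set.Ico ((j : ℝ) / b) ((j + 1 : ℝ) / b) → ⌊b * v⌋₊ = j := by
    rintro j v ⟨h1, h2⟩
    rw [div_le_iff₀' hb] at h1
    rw [lt_div_iff₀' hb] at h2
    rw [Nat.floor_eq_iff (le_trans (by positivity) h1)]
    exact ⟨h1, h2⟩
  have hdisj : Pairwise (Function.onFun Disjoint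
      fun j : ℕ => Set.Ico ((j : ℝ) / b) ((j + 1 : ℝ) / b)) := fun i j hij =>
    Set.disjoint_left.2 fun v hi hj => hij ((hfl i v hi).symm.trans (hfl j v hj))
  rw [Measure.restrict_congr_set (Ioi_ae_eq_Ici (μ := volume) (a := (0 : ℝ))), hU,
    lintegral_iUnion (fun _ => measurableSet_Ico) hdisj]
  refine tsum_congr fun j => ?_
  rw [setLIntegral_congr_fun (g := fun _ => ENNReal.ofReal b * f j) measurableSet_Ico
    fun v hv => by simp only [hfl j v hv], setLIntegral_const, Real.volume_Ico,
    mul_right_comm, ← ENNReal.ofReal_mul hb.le]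
  rw [show b * ((j + 1 : ℝ) / b - j / b) = 1 by field_simp; ring]
  simp

lemma measurable_comp_floor (b : ℝ) {β : Type*} [MeasurableSpace β] (f : ℕ → ℕ → β) :
    Measurable fun p : ℝ × ℝ => f ⌊b * p.1⌋₊ ⌊b * p.2⌋₊ := by
  have h1 : Measurable fun q : ℕ × ℕ => f q.1 q.2 := measurable_of_countable _
  exact h1.comp ((Nat.measurable_floor.comp (measurable_fst.const_mul b)).prodMk
    (Nat.measurable_floor.comp (measurable_snd.const_mul b)))

lemma tsum_tsum_eq_lintegral_floor {b : ℝ} (hb : 0 < b) (f : ℕ → ℕ → ℝ≥0∞) :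
    ∑' j, ∑' u, f j u =
      ∫⁻ p, ENNReal.ofReal (b ^ 2) * f ⌊b * p.1⌋₊ ⌊b * p.2⌋₊
        ∂((volume.restrict (Set.Ioi (0 : ℝ))).prod (volume.restrict (Set.Ioi (0 : ℝ)))) := by
  rw [lintegral_prod _ ((measurable_comp_floor b f).const_mul _).aemeasurable,
    tsum_nat_eq_lintegral_floor hb]
  refine lintegral_congr fun v => ?_
  rw [tsum_nat_eq_lintegral_floor hb, ← lintegral_const_mul' _ _ ENNReal.ofReal_ne_top]
  refine lintegral_congr fun w => ?_
  rw [← mul_assoc, ← ENNReal.ofReal_mul hb.le, sq]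

lemma heatKernel_nonneg (n : ℕ) {t : ℝ} (ht : 0 ≤ t) (j : ℤ) : 0 ≤ heatKernel n t j :=
  tsum_nonneg fun N => mul_nonneg (by positivity) (walkLaw_nonneg n N j)

/-- Three factors with separate limits: the weight at the level, the exponential cost of the
overshoot j - z, and the local limit term. The divisor b^{β-1} is later paired with the cross
section. -/
lemma bScale_sq_mul_heatKernel {n : ℕ} {β : ℝ} (hβ : 0 < β) (x : ℝ) {t : ℝ} (ht : 1 < t) (j : ℤ) :
    bScale (n + 1) β t ^ 2 * heatKernel n t j =
      tiltWeight (n + 1) β x t / bScale (n + 1) β t ^ (β - 1) *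
        Real.exp (-(tilt (n + 1) β x t * (j - level (n + 1) β x t))) *
        (√(t / (n + 1 : ℕ)) * tiltedIntegral (t / (n + 1 : ℕ)) (tilt (n + 1) β x t) j /
          (2 * Real.pi)) := by
  have hb := bScale_pos n.succ_pos hβ ht
  have ht0 : 0 < t := by linarith
  have hs : 0 < √(t / (n + 1 : ℕ)) := Real.sqrt_pos.2 (by positivity)
  have h1 : bScale (n + 1) β t ^ (β + 1) =
      bScale (n + 1) β t ^ 2 * bScale (n + 1) β t ^ (β - 1) := by
    rw [← Real.rpow_natCast, ← Real.rpow_add hb]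
    congr 1
    push_cast
    ring
  have h2 : 0 < bScale (n + 1) β t ^ (β - 1) := Real.rpow_pos_of_pos hb _
  rw [heatKernel_eq n ht0.le j (tilt (n + 1) β x t), tiltWeight, h1,
    show (n : ℝ) + 1 = ((n + 1 : ℕ) : ℝ) by push_cast; rfl,
    show t / (n + 1 : ℕ) * (Real.cosh (tilt (n + 1) β x t) - 1) - j * tilt (n + 1) β x t =
      (t / (n + 1 : ℕ) * (Real.cosh (tilt (n + 1) β x t) - 1) -
        tilt (n + 1) β x t * level (n + 1) β x t) +
      -(tilt (n + 1) β x t * (j - level (n + 1) β x t)) by ring, Real.exp_add]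
  field_simp

/-- The lattice point above `z` at rescaled distance `v + w`. -/
def latticePoint (z b v w : ℝ) : ℤ := ⌊z⌋ + 1 + (⌊b * v⌋₊ : ℤ) + (⌊b * w⌋₊ : ℤ)

/-- Each of the two natural floors loses at most 1, while ⌊z⌋ + 1 - z is positive. -/
lemma le_latticePoint_sub (z b v w : ℝ) : b * (v + w) - 2 ≤ latticePoint z b v w - z := by
  have h1 := Int.lt_floor_add_one z
  have h2 := Nat.lt_floor_add_one (b * v)
  have h3 := Nat.lt_floor_add_one (b * w)
  unfold latticePoint
  push_cast
  linarith

lemma tendsto_latticePoint_sub_div {ι : Type*} {l : Filter ι} {b z : ι → ℝ}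
    (hb : Tendsto b l atTop) {v w : ℝ} (hv : 0 ≤ v) (hw : 0 ≤ w) :
    Tendsto (fun i => (latticePoint (z i) (b i) v w - z i) / b i) l (𝓝 (v + w)) := by
  have hinv : Tendsto (fun i => (b i)⁻¹) l (𝓝 0) := tendsto_inv_atTop_zero.comp hb
  have h0 : Tendsto (fun i => ((⌊z i⌋ : ℝ) + 1 - z i) * (b i)⁻¹) l (𝓝 0) := by
    refine squeeze_zero_norm' ?_ hinv
    filter_upwards [hb.eventually_gt_atTop 0] with i hi
    rw [norm_mul, Real.norm_of_nonneg (by positivity : (0 : ℝ) ≤ (b i)⁻¹)]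
    refine mul_le_of_le_one_left (by positivity) ?_
    have h1 := Int.lt_floor_add_one (z i)
    have h2 := Int.floor_le (z i)
    rw [Real.norm_eq_abs, abs_le]
    constructor <;> linarith
  have := (h0.add (tendsto_floor_mul_div hb hv)).add (tendsto_floor_mul_div hb hw)
  rw [zero_add] at this
  refine this.congr fun i => ?_
  unfold latticePoint
  push_cast
  ring

/-- The rate β/4 is chosen below the decay rate β/2 available in `rescaledSummand_le`, so that β/4
remains. -/
lemma one_add_rpow_le {β w : ℝ} (hβ : 1 ≤ β) (hw : 0 ≤ w) :
    (1 + w) ^ (β - 1) ≤ 4 ^ (β - 1) * Real.exp (β / 4 * w) := by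
  have h1 : 1 + w ≤ 4 * Real.exp (w / 4) := by linarith [Real.add_one_le_exp (w / 4)]
  calc (1 + w) ^ (β - 1) ≤ (4 * Real.exp (w / 4)) ^ (β - 1) :=
        Real.rpow_le_rpow (by linarith) h1 (by linarith)
    _ = 4 ^ (β - 1) * Real.exp (w / 4 * (β - 1)) := by
        rw [Real.mul_rpow (by norm_num) (Real.exp_pos _).le, ← Real.exp_mul]
    _ ≤ _ := by
        refine mul_le_mul_of_nonneg_left (Real.exp_le_exp.2 ?_) (by positivity)
        linarith

/-! ### Dominated convergence and the limiting constant. -/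

section Main

variable {n : ℕ} {c α r : Fin n → ℝ}

lemma one_le_beta (hα : ∀ i, 0 ≤ α i) : 1 ≤ beta α :=
  le_add_of_nonneg_right (Finset.sum_nonneg fun i _ => hα i)

/-- The rescaled summand of the mean number of particles above the level. -/
def rescaledSummand (c α r : Fin n → ℝ) (x t : ℝ) (p : ℝ × ℝ) : ℝ :=
  bScale (n + 1) (beta α) t ^ 2 *
    (heatKernel n t (latticePoint (level (n + 1) (beta α) x t) (bScale (n + 1) (beta α) t) p.1 p.2) *
      crossSection (polyShape c α r) (⌊bScale (n + 1) (beta α) t * p.2⌋₊ : ℝ))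

/-- The limit of the weights `tiltWeight`. -/
def weightLimit (d : ℕ) (β x : ℝ) : ℝ :=
  β ^ ((β + 1) / 2) * (d : ℝ) ^ (-(β / 2)) * Real.exp (-(β * x)) * √(2 * Real.pi)

lemma rescaledSummand_eq (hα : ∀ i, 0 ≤ α i) (x : ℝ) {t : ℝ} (ht : 1 < t) (p : ℝ × ℝ) :
    rescaledSummand c α r x t p = tiltWeight (n + 1) (beta α) x t *
      (crossSection (polyShape c α r) (⌊bScale (n + 1) (beta α) t * p.2⌋₊ : ℝ) /
        bScale (n + 1) (beta α) t ^ (beta α - 1)) *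
      Real.exp (-(tilt (n + 1) (beta α) x t *
        (latticePoint (level (n + 1) (beta α) x t) (bScale (n + 1) (beta α) t) p.1 p.2 -
          level (n + 1) (beta α) x t))) *
      (√(t / (n + 1 : ℕ)) * tiltedIntegral (t / (n + 1 : ℕ)) (tilt (n + 1) (beta α) x t)
        (latticePoint (level (n + 1) (beta α) x t) (bScale (n + 1) (beta α) t) p.1 p.2) /
          (2 * Real.pi)) := by
  rw [rescaledSummand, ← mul_assoc,
    bScale_sq_mul_heatKernel (zero_lt_one.trans_le (one_le_beta hα)) x ht]
  ring

lemma rescaledSummand_le (hc : ∀ i, 0 < c i) (hα : ∀ i, 0 ≤ α i) (hr : ∀ i, 0 ≤ r i) (x : ℝ) :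
    ∃ B : ℝ, ∀ᶠ t in atTop, ∀ p : ℝ × ℝ, 0 < p.1 → 0 < p.2 → rescaledSummand c α r x t p ≤
      B * (Real.exp (-(beta α / 4) * p.1) * Real.exp (-(beta α / 4) * p.2)) := by
  have hβ1 : 1 ≤ beta α := one_le_beta hα
  have hβ : 0 < beta α := by linarith
  set β := beta α with hβdef
  set Kc := ∫ y : ℝ, Real.exp (-(2 / Real.pi ^ 2) * y ^ 2)
  have hKc : 0 ≤ Kc := integral_nonneg fun _ => (Real.exp_pos _).le
  set K0 := ∏ i, (2 * c i + 2 * r i + 1)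
  have hK0 : 0 ≤ K0 := Finset.prod_nonneg fun i _ => by
    have := (hc i).le
    have := hr i
    positivity
  have hπ := Real.pi_pos
  have hA0 : 0 ≤ weightLimit (n + 1) β x := by unfold weightLimit; positivity
  -- In order: an eventual bound for the weight, the cross-section constant, the rounding loss of 2
  -- with θ < 1, and the Gaussian bound on the tilted integral.
  refine ⟨(weightLimit (n + 1) β x + 1) * (K0 * 4 ^ (β - 1)) * Real.exp 2 * (Kc / (2 * Real.pi)), ?_⟩
  have hd : 0 < n + 1 := n.succ_pos
  filter_upwards [eventually_gt_atTop 1,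
    (tendsto_tiltWeight hd hβ x).eventually (gt_mem_nhds (lt_add_one _)),
    (tendsto_bScale hd hβ).eventually_ge_atTop 1,
    (tendsto_tilt hd hβ x).eventually (gt_mem_nhds one_pos),
    -- Half of the limiting rate β is kept; the slack makes the bound uniform in large t.
    (tendsto_tilt_mul_bScale hd hβ x).eventually (lt_mem_nhds (half_lt_self hβ))]
    with t ht hA hb hθ1 hθb p hp1 hp2
  have ht0 : 0 < t := by linarith
  set b := bScale (n + 1) β t
  set θ := tilt (n + 1) β x t
  have hb0 : 0 < b := by linarith
  have hθ0 : 0 < θ := by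
    by_contra h
    push Not at h
    nlinarith [mul_nonneg (neg_nonneg.2 h) hb0.le]
  have hW0 : 0 ≤ tiltWeight (n + 1) β x t := by
    unfold tiltWeight
    exact mul_nonneg (div_nonneg (Real.rpow_nonneg hb0.le _) (Real.sqrt_nonneg _))
      (Real.exp_pos _).le
  have hG := crossSection_polyShape_div_le hc hα hr hb hp2.le
  have hG0 : 0 ≤ crossSection (polyShape c α r) (⌊b * p.2⌋₊ : ℝ) / b ^ (β - 1) :=
    div_nonneg (crossSection_nonneg fun i => polyShape_nonneg hc hr i (by positivity))
      (Real.rpow_nonneg hb0.le _)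
  have hG' : crossSection (polyShape c α r) (⌊b * p.2⌋₊ : ℝ) / b ^ (β - 1) ≤
      K0 * 4 ^ (β - 1) * Real.exp (β / 4 * p.2) := by
    rw [mul_assoc]
    exact hG.trans (mul_le_mul_of_nonneg_left (one_add_rpow_le hβ1 hp2.le) hK0)
  have hE : Real.exp (-(θ * (latticePoint (level (n + 1) β x t) b p.1 p.2 -
      level (n + 1) β x t))) ≤ Real.exp 2 * Real.exp (-(β / 2) * (p.1 + p.2)) := by
    rw [← Real.exp_add, Real.exp_le_exp]
    have h1 := mul_le_mul_of_nonneg_left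
      (le_latticePoint_sub (level (n + 1) β x t) b p.1 p.2) hθ0.le
    have h2 := mul_le_mul_of_nonneg_right hθb.le (add_pos hp1 hp2).le
    nlinarith
  have hT : √(t / (n + 1 : ℕ)) * tiltedIntegral (t / (n + 1 : ℕ)) θ
        (latticePoint (level (n + 1) β x t) b p.1 p.2) / (2 * Real.pi) ≤ Kc / (2 * Real.pi) := by
    gcongr
    exact (le_abs_self _).trans (abs_sqrt_mul_tiltedIntegral_le (by positivity) _ _)
  rw [rescaledSummand_eq hα x ht]
  calc _ ≤ tiltWeight (n + 1) β x t *
        (crossSection (polyShape c α r) (⌊b * p.2⌋₊ : ℝ) / b ^ (β - 1)) *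
        Real.exp (-(θ * (latticePoint (level (n + 1) β x t) b p.1 p.2 -
          level (n + 1) β x t))) * (Kc / (2 * Real.pi)) := by
        refine mul_le_mul_of_nonneg_left hT ?_
        exact mul_nonneg (mul_nonneg hW0 hG0) (Real.exp_pos _).le
    _ ≤ (weightLimit (n + 1) β x + 1) * (K0 * 4 ^ (β - 1) * Real.exp (β / 4 * p.2)) *
        (Real.exp 2 * Real.exp (-(β / 2) * (p.1 + p.2))) * (Kc / (2 * Real.pi)) := by
        refine mul_le_mul_of_nonneg_right ?_ (by positivity)
        refine mul_le_mul ?_ hE (Real.exp_pos _).le (by positivity)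
        exact mul_le_mul hA.le hG' hG0 (by positivity)
    _ = (weightLimit (n + 1) β x + 1) * (K0 * 4 ^ (β - 1)) * Real.exp 2 * (Kc / (2 * Real.pi)) *
        (Real.exp (β / 4 * p.2) * Real.exp (-(β / 2) * (p.1 + p.2))) := by ring
    _ ≤ _ := by
        refine mul_le_mul_of_nonneg_left ?_ (by positivity)
        rw [← Real.exp_add, ← Real.exp_add, Real.exp_le_exp]
        nlinarith

lemma tendsto_rescaledSummand (hα : ∀ i, 0 ≤ α i) (x : ℝ) {p : ℝ × ℝ}
    (hp1 : 0 < p.1) (hp2 : 0 < p.2) :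
    Tendsto (fun t => rescaledSummand c α r x t p) atTop
      (𝓝 (weightLimit (n + 1) (beta α) x * leadingCoeff c α r * (√(2 * Real.pi) / (2 * Real.pi)) *
        (Real.exp (-beta α * p.1) * (p.2 ^ (beta α - 1) * Real.exp (-(beta α * p.2)))))) := by
  have hβ : 0 < beta α := zero_lt_one.trans_le (one_le_beta hα)
  have hd : 0 < n + 1 := n.succ_pos
  set β := beta α with hβdef
  have hb := tendsto_bScale (d := n + 1) hd hβ
  have hlp := tendsto_latticePoint_sub_div (z := level (n + 1) β x) hb hp1.le hp2.le
  have hexp := (Real.continuous_exp.tendsto _).comp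
    ((tendsto_tilt_mul_bScale (d := n + 1) hd hβ x).mul hlp).neg
  have hτ : Tendsto (fun t : ℝ => t / (n + 1 : ℕ)) atTop atTop :=
    tendsto_id.atTop_div_const (by positivity)
  have hT := (tendsto_sqrt_mul_tiltedIntegral hτ (tendsto_tilt (d := n + 1) hd hβ x)
    (tendsto_sqrt_mul_tilt_pow_three hd hβ x)
    (a := fun t => (latticePoint (level (n + 1) β x t) (bScale (n + 1) β t) p.1 p.2 : ℝ))
    -- With level = τθ, the centring error is the product of the bounded overshoot (j - z)/b_t and
    -- the vanishing ratio b_t/√τ.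
    (by
      have := hlp.mul (tendsto_bScale_div_sqrt (d := n + 1) hd hβ)
      rw [mul_zero] at this
      refine this.congr' ?_
      filter_upwards [eventually_gt_atTop 1] with t ht
      have hb0 := bScale_pos (d := n + 1) hd hβ ht
      rw [← level_eq_mul_tilt hd x ht]
      field_simp)).div_const (2 * Real.pi)
  have hall := (((tendsto_tiltWeight (d := n + 1) hd hβ x).mul
    (tendsto_crossSection_polyShape_div (c := c) (r := r) hα hb hp2)).mul hexp).mul hT
  have hval : weightLimit (n + 1) β x * leadingCoeff c α r * (√(2 * Real.pi) / (2 * Real.pi)) *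
      (Real.exp (-β * p.1) * (p.2 ^ (β - 1) * Real.exp (-(β * p.2)))) =
      β ^ ((β + 1) / 2) * ((n + 1 : ℕ) : ℝ) ^ (-(β / 2)) * Real.exp (-(β * x)) * √(2 * Real.pi) *
        (leadingCoeff c α r * p.2 ^ (β - 1)) * Real.exp (-(β * (p.1 + p.2))) *
        (√(2 * Real.pi) / (2 * Real.pi)) := by
    rw [show -(β * (p.1 + p.2)) = -β * p.1 + -(β * p.2) by ring, Real.exp_add, weightLimit]
    ring
  rw [hval]
  refine hall.congr' ?_
  filter_upwards [eventually_gt_atTop 1] with t ht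
  have hb0 := bScale_pos (d := n + 1) hd hβ ht
  rw [rescaledSummand_eq hα x ht, Function.comp, ← hβdef]
  congr 3
  field_simp

lemma leadingCoeff_nonneg (hc : ∀ i, 0 < c i) (hr : ∀ i, 0 ≤ r i) : 0 ≤ leadingCoeff c α r := by
  refine mul_nonneg (Finset.prod_nonneg fun i _ => ?_) (Finset.prod_nonneg fun i _ => ?_)
  · have : (0 : ℝ) ≤ ⌊c i + r i⌋ := by
      exact_mod_cast Int.floor_nonneg.2 (add_nonneg (hc i).le (hr i))
    positivity
  · have := (hc i).le
    positivity

/-- One √(2π) comes from a_t and one from the Gaussian integral; together they cancel the 2π of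
Fourier inversion. The powers of β combine as (β+1)/2 - 1 - β = -(β+1)/2. -/
lemma weightLimit_mul_leadingCoeff (hα : ∀ i, 0 ≤ α i) (x : ℝ) :
    weightLimit (n + 1) (beta α) x * leadingCoeff c α r * (√(2 * Real.pi) / (2 * Real.pi)) *
      (1 / beta α * ((1 / beta α) ^ beta α * Real.Gamma (beta α))) =
    limitConst c α r * Real.exp (-(beta α * x)) := by
  have hβ : 0 < beta α := zero_lt_one.trans_le (one_le_beta hα)
  have hπ := Real.pi_pos
  have h1 : √(2 * Real.pi) * (√(2 * Real.pi) / (2 * Real.pi)) = 1 := by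
    rw [← mul_div_assoc, Real.mul_self_sqrt (by positivity)]
    field_simp
  have h2 : beta α ^ ((beta α + 1) / 2) * (1 / beta α * (1 / beta α) ^ beta α) =
      (beta α ^ ((beta α + 1) / 2))⁻¹ := by
    rw [one_div, Real.inv_rpow hβ.le, ← Real.rpow_neg hβ.le, ← Real.rpow_neg hβ.le,
      ← Real.rpow_neg_one, ← Real.rpow_add hβ, ← Real.rpow_add hβ]
    congr 1
    ring
  have h3 : limitConst c α r = Real.Gamma (beta α) /
      (((n + 1 : ℕ) : ℝ) ^ (beta α / 2) * beta α ^ ((beta α + 1) / 2)) * leadingCoeff c α r := by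
    rw [limitConst, leadingCoeff, mul_assoc]
  rw [h3, weightLimit, Real.rpow_neg (by positivity)]
  calc _ = (beta α ^ ((beta α + 1) / 2) * (1 / beta α * (1 / beta α) ^ beta α)) *
        (√(2 * Real.pi) * (√(2 * Real.pi) / (2 * Real.pi))) *
        ((((n + 1 : ℕ) : ℝ) ^ (beta α / 2))⁻¹ * Real.exp (-(beta α * x)) * leadingCoeff c α r *
          Real.Gamma (beta α)) := by ring
    _ = _ := by
      rw [h1, h2, div_eq_mul_inv (Real.Gamma (beta α)), mul_inv]
      ring

lemma tendsto_tsum_heatKernel_mul_crossSection (hc : ∀ i, 0 < c i) (hα : ∀ i, 0 ≤ α i)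
    (hr : ∀ i, 0 ≤ r i) (x : ℝ) :
    Tendsto (fun t : ℝ => ∑' j : ℕ, ∑' u : ℕ,
        ENNReal.ofReal (heatKernel n t (⌊level (n + 1) (beta α) x t⌋ + 1 + j + u)) *
          ENNReal.ofReal (crossSection (polyShape c α r) u)) atTop
      (𝓝 (ENNReal.ofReal (limitConst c α r * Real.exp (-(beta α * x))))) := by
  have hβ1 : 1 ≤ beta α := one_le_beta hα
  have hβ : 0 < beta α := by linarith
  obtain ⟨B, hB⟩ := rescaledSummand_le hc hα hr x
  set ν := (volume.restrict (Set.Ioi (0 : ℝ))).prod (volume.restrict (Set.Ioi (0 : ℝ))) with hν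
  -- The pointwise bound and limit are available only on the open quadrant, which carries all of ν.
  have hae : ∀ᵐ p ∂ν, 0 < p.1 ∧ 0 < p.2 := by
    rw [hν, Measure.prod_restrict]
    exact ae_restrict_mem (measurableSet_Ioi.prod measurableSet_Ioi)
  -- This rewriting is exact: the integrand is constant on cells of side 1/b_t, and b_t² is the
  -- inverse cell area.
  have hsum : ∀ t : ℝ, 1 < t → ∑' j : ℕ, ∑' u : ℕ,
      ENNReal.ofReal (heatKernel n t (⌊level (n + 1) (beta α) x t⌋ + 1 + j + u)) *
        ENNReal.ofReal (crossSection (polyShape c α r) u) =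
      ∫⁻ p, ENNReal.ofReal (rescaledSummand c α r x t p) ∂ν := fun t ht => by
    rw [tsum_tsum_eq_lintegral_floor (bScale_pos n.succ_pos hβ ht)]
    refine lintegral_congr fun p => ?_
    rw [rescaledSummand, ENNReal.ofReal_mul (by positivity),
      ENNReal.ofReal_mul (heatKernel_nonneg n (by linarith) _)]
    rfl
  have hmeas : ∀ t, Measurable (rescaledSummand c α r x t) := fun t => by
    have := measurable_comp_floor (bScale (n + 1) (beta α) t) fun j u =>
      heatKernel n t (⌊level (n + 1) (beta α) x t⌋ + 1 + j + u) *
        crossSection (polyShape c α r) u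
    exact this.const_mul _
  have hboundint : Integrable (fun p : ℝ × ℝ =>
      B * (Real.exp (-(beta α / 4) * p.1) * Real.exp (-(beta α / 4) * p.2))) ν :=
    Integrable.const_mul (Integrable.mul_prod
      (exp_neg_integrableOn_Ioi 0 (by positivity : 0 < beta α / 4))
      (exp_neg_integrableOn_Ioi 0 (by positivity : 0 < beta α / 4))) B
  have hlimint : Integrable (fun p : ℝ × ℝ =>
      Real.exp (-beta α * p.1) * (p.2 ^ (beta α - 1) * Real.exp (-(beta α * p.2)))) ν := by
    refine Integrable.mul_prod (f := fun v => Real.exp (-beta α * v))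
      (g := fun w => w ^ (beta α - 1) * Real.exp (-(beta α * w)))
      (exp_neg_integrableOn_Ioi 0 hβ) ?_
    have := integrableOn_rpow_mul_exp_neg_mul_rpow (p := 1) (s := beta α - 1) (b := beta α)
      (by linarith) one_pos hβ
    simpa only [IntegrableOn, Real.rpow_one, neg_mul] using this
  have hlim := tendsto_lintegral_filter_of_dominated_convergence (μ := ν) (l := atTop)
    (F := fun t p => ENNReal.ofReal (rescaledSummand c α r x t p))
    (fun p => ENNReal.ofReal
      (B * (Real.exp (-(beta α / 4) * p.1) * Real.exp (-(beta α / 4) * p.2))))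
    (Eventually.of_forall fun t => (hmeas t).ennreal_ofReal)
    (hB.mono fun t h => hae.mono fun p hp => ENNReal.ofReal_le_ofReal (h p hp.1 hp.2))
    hboundint.lintegral_lt_top.ne
    (hae.mono fun p hp => ENNReal.tendsto_ofReal (tendsto_rescaledSummand hα x hp.1 hp.2))
  have hval : ∫⁻ p, ENNReal.ofReal (weightLimit (n + 1) (beta α) x * leadingCoeff c α r *
      (√(2 * Real.pi) / (2 * Real.pi)) *
        (Real.exp (-beta α * p.1) * (p.2 ^ (beta α - 1) * Real.exp (-(beta α * p.2))))) ∂ν =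
      ENNReal.ofReal (limitConst c α r * Real.exp (-(beta α * x))) := by
    have hA0 : 0 ≤ weightLimit (n + 1) (beta α) x := by unfold weightLimit; positivity
    have hC0 : 0 ≤ leadingCoeff c α r := leadingCoeff_nonneg hc hr
    rw [← ofReal_integral_eq_lintegral_ofReal (hlimint.const_mul _)]
    · rw [integral_const_mul, integral_prod_mul (fun v : ℝ => Real.exp (-beta α * v))
        (fun w : ℝ => w ^ (beta α - 1) * Real.exp (-(beta α * w))),
        Real.integral_rpow_mul_exp_neg_mul_Ioi hβ hβ, integral_exp_mul_Ioi (by linarith),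
        ← weightLimit_mul_leadingCoeff hα]
      congr 3
      simp
    · filter_upwards [hae] with p hp
      have := hp.2
      positivity
  rw [hval] at hlim
  refine hlim.congr' ?_
  filter_upwards [eventually_gt_atTop 1] with t ht
  exact (hsum t ht).symm

end Main

end SSEP

end

/-- The dimension is `d = n + 1 ≥ 2`. -/
theorem lemma5p2 (n : ℕ) (hn : 1 ≤ n) (c α r : Fin n → ℝ)
    (hc : ∀ i, 0 < c i) (hα : ∀ i, 0 ≤ α i) (hr : ∀ i, 0 ≤ r i) (x : ℝ)
    {Ω : Type*} {m : MeasurableSpace Ω} (μ : Measure Ω) [IsProbabilityMeasure μ]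
    (ℱ : Filtration ℝ≥0 m) (η : ℝ≥0 → Ω → SSEP.Config (n + 1))
    (hη : SSEP.IsSSEP μ ℱ η (SSEP.profile (SSEP.polyShape c α r))) :
    Tendsto
      (fun t : ℝ≥0 => ∫⁻ ω, SSEP.numAbove (SSEP.level (n + 1) (SSEP.beta α) x t) (η t ω) ∂μ)
      atTop
      (𝓝 (ENNReal.ofReal (SSEP.limitConst c α r * Real.exp (-(SSEP.beta α * x))))) := by
  refine ((SSEP.tendsto_tsum_heatKernel_mul_crossSection hc hα hr x).comp
    (NNReal.tendsto_coe_atTop.2 tendsto_id)).congr fun t => ?_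
  exact (SSEP.lintegral_numAbove hη (SSEP.fiberMass_profile fun i u =>
    SSEP.polyShape_nonneg hc hr i u.cast_nonneg) _ t).symm
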